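/- **Setting.** Let $P$ be a $k\times k$ transition matrix (entries in $\{0,1\}$, no null row), $\Omega=\{x\in\{1,\dots,k\}^{\mathbb Z}: P_{x_n,x_{n+1}}=1\ \forall n\in\mathbb Z\}$, $\sigma:\Omega\to\Omega$ the left shift and, for a fixed $\rho>1$, $d_\Omega(x,y)=\rho^{-N}$ with $N=\max\{N\ge 0: x_n=y_n\ \forall |n|<N\}$ ($d_\Omega(x,x)=0$). Let $W^s(x)$, $W^u(x)$ be the sets of $y$ with $y_n=x_n$ for all sufficiently large $n$, respectively all sufficiently negative $n$; let $W^s_{\rm loc}(x)$, $W^u_{\rm loc}(x)$ be the sets of $y$ with $y_n=x_n$ for all $n\ge 0$, respectively all $n\le 0$. Let $(G,+)$ be a compact topological group with a compatible metric $d$, and $\operatorname{Hom}(G)$ the set of its homeomorphisms, with $d_\infty(e_1,e_2)=\sup_p d(e_1(p),e_2(p))$. For $0<\beta\le 1$ let $\operatorname{Hol}_\beta(G)$ be the set of $e\in \operatorname{Hom}(G)$ with $e$ and $e^{-1}$ $\beta$-Hölder; $\operatorname{Lip}(G)=\operatorname{Hol}_1(G)$, $L(\cdot)$ is the Lipschitz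 constant and $d_1(e_1,e_2)=d_\infty(e_1,e_2)+L(e_1-e_2)$. An $\alpha$-Hölder cocycle is given by an $\alpha$-Hölder map $f:(\Omega,d_\Omega)\to(\operatorname{Lip}(G),d_1)$, $0<\alpha\le 1$; put $f^n_x=f_{\sigma^{n-1}(x)}\circ\dots\circ f_x$ and $f^{-n}_x=(f^n_{\sigma^{-n}(x)})^{-1}$ for $n\ge 0$. It is su-dominated with constant $\theta>0$ if $L(f_x)<\rho^{\alpha-\theta}$ and $L(f_x^{-1})<\rho^{\alpha-\theta}$ for all $x\in\Omega$. It has $\mu$-bounded distortion if there is $K$ such that, for all $n\in\mathbb N$ and $\mu$-a.e. $x$, $L(f^n_x)<K$ and $L((f^n_x)^{-1})<K$. Its holonomies are the uniform limits $h^s_{xy}=\lim_{n\to\infty}(f^n_y)^{-1}f^n_x$ for $y\in W^s(x)$ and $h^u_{xy}=\lim_{n\to\infty}(f^{-n}_y)^{-1}f^{-n}_x$ for $y\in W^u(x)$; they are said to be $\gamma$-Hölder if (for $*\in\{s,u\}$) these limits exist, $h^*_{xx}=\mathrm{Id}$, $h^*_{yz}h^*_{xy}=h^*_{xz}$, $f_yh^*_{xy}=h^*_{\sigma(x)\sigma(y)}f_x$,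 and, for $y\in W^*_{\rm loc}(x)$, $h^*_{xy}(p)$ is continuous in $(x,y,p)$ and $h^*_{xy}$ is $\gamma$-Hölder with a constant independent of $x,y$. A $\sigma$-invariant probability measure $\mu$ has local product structure if there is a continuous $D:\Omega\to(0,\infty)$ such that, for each symbol $i$ and measurable $E\subset\{x:x_0=i\}$, $\mu(E)=\int (\chi_E\circ\psi_i)\,(D\circ\psi_i)\,d(\mu^u\times\mu^s)$, where $\mu^s,\mu^u$ are the projections of $\mu$ to the coordinates $n\ge0$ and $n\le 0$, and $\psi_i$ glues a past and a future having zeroth coordinate $i$. **Theorem B.** Let $0<\alpha\le1$ and $\theta>0$. There is $\gamma\in(0,\alpha)$, depending only on $\alpha$ and $\theta$, such that for all $\rho$, $P$ and $G$ as above and every $\alpha$-Hölder cocycle $F$ given by $f$ that is su-dominated with constant $\theta$, the stable and unstable holonomies of $F$ exist and are $\gamma$-Hölder, and the following holds. Let $\mu$ be an ergodic $\sigma$-invariant probability measure on $\Omega$ with full support and local product structure, let $g$ define a second $\alpha$-Hölder cocycle over $\sigma$, with values in $\operatorname{Lip}(G)$, with $\mu$-bounded distortion, let $0<\beta\le 1$,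 and let $\phi:\Omega\to(\operatorname{Hol}_\beta(G),d_\infty)$ be a $\mu$-measurable conjugacy, i.e. $f_x=\phi_{\sigma(x)}\,g_x\,\phi_x^{-1}$ for $\mu$-a.e. $x$. Then there is $\tilde\phi:\Omega\to(\operatorname{Hom}(G),d_\infty)$, $\beta\gamma$-Hölder, with $\tilde\phi_x=\phi_x$ for $\mu$-a.e. $x$ and $f_x=\tilde\phi_{\sigma(x)}\,g_x\,\tilde\phi_x^{-1}$ for all $x\in\Omega$. -/

import Mathlib

open MeasureTheory Filter Topology
open scoped NNReal ENNReal

noncomputable section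

namespace LipCocycle

/-! ### Subshifts of finite type -/

/-- A transition matrix on `k` symbols: entries in `{0, 1}` and no null row. -/
def IsTransitionMatrix {k : ℕ} (P : Matrix (Fin k) (Fin k) ℕ) : Prop :=
  (∀ i j, P i j = 0 ∨ P i j = 1) ∧ ∀ i, ∃ j, P i j = 1

/-- The space `Ω` of bi-infinite admissible sequences, with the topology and the (Borel)
σ-algebra induced by the product of the discrete ones. -/
abbrev Omega {k : ℕ} (P : Matrix (Fin k) (Fin k) ℕ) : Type :=
  {x : ℤ → Fin k // ∀ n : ℤ, P (x n) (x (n + 1)) = 1}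

/-- Admissible sequences indexed by the coordinates `n ≥ 0`. -/
abbrev OmegaPlus {k : ℕ} (P : Matrix (Fin k) (Fin k) ℕ) : Type :=
  {b : ℕ → Fin k // ∀ n : ℕ, P (b n) (b (n + 1)) = 1}

/-- Admissible sequences indexed by the coordinates `n ≤ 0`; the entry of index `n : ℕ`
is the coordinate at `-n`. -/
abbrev OmegaMinus {k : ℕ} (P : Matrix (Fin k) (Fin k) ℕ) : Type :=
  {a : ℕ → Fin k // ∀ n : ℕ, P (a (n + 1)) (a n) = 1}

section Shift

variable {k : ℕ} {P : Matrix (Fin k) (Fin k) ℕ}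

/-- The left shift `(σ x)_n = x_{n+1}`, as a homeomorphism of `Ω`. -/
def shift (P : Matrix (Fin k) (Fin k) ℕ) : Omega P ≃ₜ Omega P where
  toFun x := ⟨fun n => x.1 (n + 1), fun n => x.2 (n + 1)⟩
  invFun x := ⟨fun n => x.1 (n - 1), fun n => by
    have h := x.2 (n - 1)
    rwa [show n - 1 + 1 = n + 1 - 1 by ring] at h⟩
  left_inv x := by
    apply Subtype.ext
    funext n
    simp
  right_inv x := by
    apply Subtype.ext
    funext n
    simp
  continuous_toFun := by
    refine Continuous.subtype_mk (continuous_pi fun n => ?_) _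
    exact (continuous_apply (n + 1)).comp continuous_subtype_val
  continuous_invFun := by
    refine Continuous.subtype_mk (continuous_pi fun n => ?_) _
    exact (continuous_apply (n - 1)).comp continuous_subtype_val

open Classical in
/-- The distance `d_ρ(x, y) = ρ^{-N}` with `N` the largest natural number such that
`x_n = y_n` for all `|n| < N`; it is `0` if `x = y`. -/
def dOmega (ρ : ℝ) (x y : Omega P) : ℝ :=
  if x = y then 0
  else (ρ ^ sSup {N : ℕ | ∀ n : ℤ, |n| < (N : ℤ) → x.1 n = y.1 n})⁻¹

/-- The local stable set of `x`. -/
def WsLoc (x : Omega P) : Set (Omega P) := {y | ∀ n : ℤ, 0 ≤ n → x.1 n = y.1 n}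

/-- The local unstable set of `x`. -/
def WuLoc (x : Omega P) : Set (Omega P) := {y | ∀ n : ℤ, n ≤ 0 → x.1 n = y.1 n}

/-- The stable set of `x`. -/
def Ws (x : Omega P) : Set (Omega P) := {y | ∃ m : ℤ, ∀ n : ℤ, m ≤ n → x.1 n = y.1 n}

/-- The unstable set of `x`. -/
def Wu (x : Omega P) : Set (Omega P) := {y | ∃ m : ℤ, ∀ n : ℤ, n ≤ m → x.1 n = y.1 n}

/-! ### Local product structure -/

/-- The projection `P^s` onto the coordinates `n ≥ 0`. -/
def projS (x : Omega P) : OmegaPlus P :=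
  ⟨fun n => x.1 (n : ℤ), fun n => by simpa using x.2 (n : ℤ)⟩

/-- The projection `P^u` onto the coordinates `n ≤ 0`. -/
def projU (x : Omega P) : OmegaMinus P :=
  ⟨fun n => x.1 (-(n : ℤ)), fun n => by
    have h := x.2 (-((n + 1 : ℕ) : ℤ))
    rwa [show -((n + 1 : ℕ) : ℤ) + 1 = -(n : ℤ) by push_cast; ring] at h⟩

/-- The element of `Ω` with past `a` and future `b`, for `a` and `b` with the same
zeroth coordinate. -/
def glue (a : OmegaMinus P) (b : OmegaPlus P) (h : a.1 0 = b.1 0) : Omega P :=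
  ⟨fun n => if 0 ≤ n then b.1 n.toNat else a.1 (-n).toNat, fun n => by
    rcases lt_trichotomy n (-1) with hn | hn | hn
    · have h1 : ¬ (0 ≤ n) := by omega
      have h2 : ¬ (0 ≤ n + 1) := by omega
      have h3 : (-n).toNat = (-(n + 1)).toNat + 1 := by omega
      simp only [h1, h2, if_false, h3]
      exact a.2 _
    · subst hn
      simpa [h] using a.2 0
    · have h1 : 0 ≤ n := by omega
      have h2 : 0 ≤ n + 1 := by omega
      have h3 : (n + 1).toNat = n.toNat + 1 := by omega
      simp only [h1, h2, if_true, h3]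
      exact b.2 _⟩

open Classical in
/-- Local product structure of `μ`: with `μ^s` and `μ^u` the projections of `μ` to futures and
pasts, there is a continuous `D : Ω → (0, ∞)` such that, for each symbol `i` and each measurable
`E ⊆ [0; i]`, `μ(E) = ∫ (χ_E ∘ ψ_i) (D ∘ ψ_i) d(μ^u × μ^s)`, where `ψ_i` glues a past and a future
with zeroth coordinate `i`. -/
def HasLocalProductStructure (μ : Measure (Omega P)) : Prop :=
  ∃ D : Omega P → ℝ, Continuous D ∧ (∀ x, 0 < D x) ∧
    ∀ (i : Fin k) (E : Set (Omega P)), MeasurableSet E → E ⊆ {x | x.1 0 = i} →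
      μ E = ∫⁻ q : OmegaMinus P × OmegaPlus P,
        (if h : q.1.1 0 = i ∧ q.2.1 0 = i then
          E.indicator (fun x => ENNReal.ofReal (D x)) (glue q.1 q.2 (h.1.trans h.2.symm))
        else 0) ∂((μ.map projU).prod (μ.map projS))

end Shift

/-! ### Hölder homeomorphisms of the fibre -/

section Fibre

variable {G : Type*} [AddGroup G] [MetricSpace G]

/-- `e ∈ Hol_β(G)`: both `e` and its inverse are `β`-Hölder. For `β = 1` this is `Lip(G)`. -/
def IsHolderHomeo (β : ℝ≥0) (e : G ≃ₜ G) : Prop :=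
  MemHolder β e ∧ MemHolder β e.symm

/-- The Lipschitz constant `L(u)`, infinite if `u` is not Lipschitz. -/
def lipConst (u : G → G) : ℝ≥0∞ := eHolderNorm 1 u

/-- The distance `d_1(e₁, e₂) = d_∞(e₁, e₂) + L(e₁ - e₂)`, with values in `[0, ∞]`. -/
def dLip (e₁ e₂ : G ≃ₜ G) : ℝ≥0∞ :=
  (⨆ p, edist (e₁ p) (e₂ p)) + lipConst (fun p => e₁ p - e₂ p)

/-- The uniform distance `d_∞`. -/
def dUnif [CompactSpace G] (e₁ e₂ : G ≃ₜ G) : ℝ := dist (e₁ : C(G, G)) (e₂ : C(G, G))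

end Fibre

/-! ### Cocycles -/

section Cocycle

variable {k : ℕ} {P : Matrix (Fin k) (Fin k) ℕ} {G : Type*}

/-- `f^n_x = f_{σ^{n-1}(x)} ∘ ⋯ ∘ f_x` for `n : ℕ`. -/
def iterNat [TopologicalSpace G] (f : Omega P → G ≃ₜ G) : ℕ → Omega P → G ≃ₜ G
  | 0, _ => 1
  | n + 1, x => f ((shift P)^[n] x) * iterNat f n x

/-- `f^n_x` for `n : ℤ`, with `f^{-n}_x = (f^n_{σ^{-n}(x)})⁻¹`. -/
def iterInt [TopologicalSpace G] (f : Omega P → G ≃ₜ G) : ℤ → Omega P → G ≃ₜ G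
  | Int.ofNat n, x => iterNat f n x
  | Int.negSucc n, x => (iterNat f (n + 1) ((shift P).symm^[n + 1] x))⁻¹

variable [AddGroup G] [MetricSpace G]

/-- `f ∈ Hol_α(Ω, Lip(G))`: an `α`-Hölder map from `(Ω, d_ρ)` to `(Lip(G), d_1)`. -/
def IsHolderCocycle (ρ : ℝ) (α : ℝ≥0) (f : Omega P → G ≃ₜ G) : Prop :=
  (∀ x, IsHolderHomeo 1 (f x)) ∧
    ∃ C : ℝ≥0, ∀ x y, dLip (f x) (f y) ≤ C * ENNReal.ofReal (dOmega ρ x y ^ (α : ℝ))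

/-- su-domination with constant `θ`. -/
def IsSUDominatedWith (ρ : ℝ) (α : ℝ≥0) (θ : ℝ) (f : Omega P → G ≃ₜ G) : Prop :=
  (∀ x, lipConst (f x).symm < ENNReal.ofReal (ρ ^ ((α : ℝ) - θ))) ∧
    ∀ x, lipConst (f x) < ENNReal.ofReal (ρ ^ ((α : ℝ) - θ))

/-- `μ`-bounded distortion. -/
def HasBoundedDistortion (μ : Measure (Omega P)) (g : Omega P → G ≃ₜ G) : Prop :=
  ∃ K : ℝ≥0, ∀ n : ℕ, ∀ᵐ x ∂μ,
    lipConst (iterNat g n x) < K ∧ lipConst (iterNat g n x).symm < K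

/-- `h` is the family of holonomies of `f` along the sets `W` (with local versions `Wloc`), and
it is `γ`-Hölder: `h_{xy} = lim (f^n_y)⁻¹ ∘ f^n_x` uniformly on `G`, where `n → l`; the usual
composition and equivariance rules hold; on the local sets `h_{xy}(p)` depends continuously on
`(x, y, p)`, and `h_{xy}` is `γ`-Hölder with a constant independent of `x` and `y`. -/
structure IsHolonomy [CompactSpace G] (f : Omega P → G ≃ₜ G) (W Wloc : Omega P → Set (Omega P))
    (l : Filter ℤ) (γ : ℝ≥0) (h : Omega P → Omega P → C(G, G)) : Prop where
  limit : ∀ x, ∀ y ∈ W x,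
    Tendsto (fun n : ℤ => (((iterInt f n y)⁻¹ * iterInt f n x : G ≃ₜ G) : C(G, G))) l (𝓝 (h x y))
  refl : ∀ x, h x x = ContinuousMap.id G
  comp : ∀ x, ∀ y ∈ W x, ∀ z ∈ W x, (h y z).comp (h x y) = h x z
  equivariant : ∀ x, ∀ y ∈ W x, ∀ p, f y (h x y p) = h (shift P x) (shift P y) (f x p)
  continuous : ContinuousOn (fun q : Omega P × Omega P × G => h q.1 q.2.1 q.2.2)
    {q | q.2.1 ∈ Wloc q.1}
  holder : ∃ C : ℝ≥0, ∀ x, ∀ y ∈ Wloc x, HolderWith C γ (h x y)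

/-- The stable and the unstable holonomies of `f` exist and are `γ`-Hölder. -/
def HasHolderHolonomies [CompactSpace G] (f : Omega P → G ≃ₜ G) (γ : ℝ≥0) : Prop :=
  (∃ h, IsHolonomy f Ws WsLoc atTop γ h) ∧ ∃ h, IsHolonomy f Wu WuLoc atBot γ h

end Cocycle

end LipCocycle

end

open LipCocycle

/-!
The argument has three parts.

*Holonomies.* Along a stable leaf `d(σ^n x, σ^n y)` decays like `ρ^{-n}`, so that `f` at the two
points differs by `O(ρ^{-α n})`, whereas `(f^n_y)⁻¹` expands at most by `ρ^{(α - θ) n}`. Hence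
`(f^n_y)⁻¹ ∘ f^n_x` converges geometrically, and its limit is within `O(d(x, y)^α)` of the identity
(`IsBunched.tendsto_hol`, `IsBunched.dist_hol_le`). Interpolating between the rate of convergence and
the Lipschitz constants of the approximations gives a Hölder exponent `γ₀` that depends only on `α`
and `θ` (`IsBunched.exists_holder_hol`). The bounded distortion inequalities of `g` extend from almost
every point to every point by continuity and full support, so that `g` has Lipschitz holonomies. The
notion `IsBunched` covers `f` and `g` alike, and is invariant under time reversal
(`IsBunched.reversal`), which turns stable into unstable holonomies.

*Invariance of the conjugacy.* If the orbits of two asymptotic points `x`, `y` return simultaneously,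
infinitely often, to a set on which `φ` is continuous and `φ⁻¹` is uniformly Hölder, then
`φ_y h^g_{xy} = h^f_{xy} φ_x` (`conjugacy_hol_of_frequently`). By Lusin's theorem such sets exist with
complement of arbitrarily small measure. For `(x, y)` distributed by `μ × μ`, local product structure
says that the law of the bracket `[x, y]`, with the past of `x` and the future of `y`, is dominated
by `μ` (`HasLocalProductStructure.exists_measure_bracket_le`). The marginals of the pairs
`(x, [x, y])` and `([x, y], y)` are then both dominated by an invariant measure, and simultaneous
returns hold almost surely by an estimate of Fatou type, without an ergodic theorem
(`ae_conjugacy_hol`).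

*Regularity.* By Fubini there is, for each symbol, a base point `w` from which holonomy invariance
determines `φ` almost everywhere on the cylinder. Transporting `φ_w` along the holonomies defines the
continuous version `ψ`, whose values are uniformly `γ₀² β`-Hölder (`exists_continuous_extension`). For
almost every pair `(x, y)` the maps `ψ_x` and `ψ_y` differ by holonomies through `[x, y]`, which are
`O(d(x, y)^α)`-close to the identity. This bounds their distance by `O(d(x, y)^{α γ₀² β})`, and the
bound extends to all pairs by density (`exists_holder_conjugacy`). So `γ = α γ₀²` works.
-/

namespace LipCocycle

/-! ### The distance of the subshift -/

section Distance

variable {k : ℕ} {P : Matrix (Fin k) (Fin k) ℕ} {ρ : ℝ} {x y z : Omega P} {N : ℕ}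

/-- The points `x` and `y` have the same coordinates of index `|n| < N`. -/
def AgreeBelow (N : ℕ) (x y : Omega P) : Prop := ∀ n : ℤ, |n| < (N : ℤ) → x.1 n = y.1 n

lemma AgreeBelow.symm (h : AgreeBelow N x y) : AgreeBelow N y x := fun n hn => (h n hn).symm

lemma AgreeBelow.trans (h : AgreeBelow N x y) (h' : AgreeBelow N y z) : AgreeBelow N x z :=
  fun n hn => (h n hn).trans (h' n hn)

lemma AgreeBelow.mono {M : ℕ} (h : AgreeBelow N x y) (hM : M ≤ N) : AgreeBelow M x y :=
  fun n hn => h n (hn.trans_le (by exact_mod_cast hM))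

lemma dOmega_self (ρ : ℝ) (x : Omega P) : dOmega ρ x x = 0 := by simp [dOmega]

lemma exists_dOmega_eq (h : x ≠ y) :
    ∃ N : ℕ, AgreeBelow N x y ∧ (∀ M, AgreeBelow M x y → M ≤ N) ∧
      ∀ ρ, dOmega ρ x y = (ρ ^ N)⁻¹ := by
  obtain ⟨n₀, hn₀⟩ : ∃ n, x.1 n ≠ y.1 n := by
    by_contra! hc
    exact h (Subtype.ext (funext hc))
  have hb : BddAbove {N : ℕ | ∀ n : ℤ, |n| < (N : ℤ) → x.1 n = y.1 n} := by
    refine ⟨n₀.natAbs, fun M hM => ?_⟩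
    by_contra! hc
    exact hn₀ (hM n₀ (by rw [Int.abs_eq_natAbs]; omega))
  have hne : {N : ℕ | ∀ n : ℤ, |n| < (N : ℤ) → x.1 n = y.1 n}.Nonempty :=
    ⟨0, fun n hn => absurd hn (by simp)⟩
  exact ⟨_, Nat.sSup_mem hne hb, fun M hM => le_csSup hb hM, fun ρ => by simp [dOmega, h]⟩

lemma dOmega_nonneg (hρ : 1 < ρ) (x y : Omega P) : 0 ≤ dOmega ρ x y := by
  unfold dOmega
  split_ifs <;> positivity

lemma dOmega_le_of_agree (hρ : 1 < ρ) (h : AgreeBelow N x y) : dOmega ρ x y ≤ (ρ ^ N)⁻¹ := by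
  by_cases hxy : x = y
  · subst hxy
    rw [dOmega_self]
    positivity
  · obtain ⟨M, -, hM, hd⟩ := exists_dOmega_eq hxy
    rw [hd]
    gcongr
    · exact hρ.le
    · exact hM N h

lemma dOmega_le_one (hρ : 1 < ρ) (x y : Omega P) : dOmega ρ x y ≤ 1 := by
  simpa using dOmega_le_of_agree (N := 0) hρ (x := x) (y := y) fun n hn => absurd hn (by simp)

/-- If agreement of `x`, `y` at the indices `|n| < N` forces agreement of `x'`, `y'` at the indices
`|n| < N + m`, then the distance contracts by the factor `ρ ^ m`. -/
lemma dOmega_le_div_pow (hρ : 1 < ρ) {x' y' : Omega P} (m : ℕ)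
    (h : ∀ N, AgreeBelow N x y → AgreeBelow (N + m) x' y') (h' : x = y → x' = y') :
    dOmega ρ x' y' ≤ dOmega ρ x y / ρ ^ m := by
  have hρ0 : 0 < ρ := by linarith
  by_cases hxy : x = y
  · rw [h' hxy, dOmega_self]
    exact div_nonneg (dOmega_nonneg hρ _ _) (by positivity)
  · obtain ⟨N, hN, -, hd⟩ := exists_dOmega_eq hxy
    refine (dOmega_le_of_agree hρ (h N hN)).trans_eq ?_
    rw [hd, pow_add, mul_inv, div_eq_mul_inv]

lemma dOmega_le_mul (hρ : 1 < ρ) {x' y' : Omega P}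
    (h : ∀ N, AgreeBelow (N + 1) x y → AgreeBelow N x' y') (h' : x = y → x' = y') :
    dOmega ρ x' y' ≤ ρ * dOmega ρ x y := by
  have hρ0 : 0 < ρ := by linarith
  by_cases hxy : x = y
  · rw [h' hxy, dOmega_self]
    exact mul_nonneg hρ0.le (dOmega_nonneg hρ _ _)
  · obtain ⟨N, hN, -, hd⟩ := exists_dOmega_eq hxy
    rw [hd]
    rcases N with - | N
    · simpa using (dOmega_le_one hρ x' y').trans hρ.le
    · refine (dOmega_le_of_agree hρ (h N hN)).trans_eq ?_
      field_simp
      ring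

lemma continuous_val_apply (n : ℤ) : Continuous fun x : Omega P => x.1 n :=
  (continuous_apply n).comp continuous_subtype_val

lemma eventually_agreeBelow (x : Omega P) (N : ℕ) : ∀ᶠ y in 𝓝 x, AgreeBelow N x y := by
  have h : ∀ n ∈ Finset.Ioo (-(N : ℤ)) N, ∀ᶠ y : Omega P in 𝓝 x, x.1 n = y.1 n := by
    intro n _
    exact ((continuous_val_apply n).tendsto x).eventually_mem
      ((isOpen_discrete {x.1 n}).mem_nhds rfl) |>.mono fun y hy => hy.symm
  filter_upwards [(Filter.eventually_all_finset _).2 h] with y hy n hn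
  exact hy n (by rw [Finset.mem_Ioo]; exact abs_lt.1 hn)

lemma isClosed_agreeBelow (N : ℕ) : IsClosed {q : Omega P × Omega P | AgreeBelow N q.1 q.2} := by
  simp only [AgreeBelow, Set.ofPred_forall]
  exact isClosed_iInter fun n => isClosed_iInter fun _ => isClosed_eq
    ((continuous_val_apply n).comp continuous_fst) ((continuous_val_apply n).comp continuous_snd)

lemma isOpen_agreeBelow (N : ℕ) : IsOpen {q : Omega P × Omega P | AgreeBelow N q.1 q.2} := by
  rw [isOpen_iff_mem_nhds]
  rintro ⟨x, y⟩ hxy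
  filter_upwards [prod_mem_nhds (eventually_agreeBelow x N) (eventually_agreeBelow y N)]
    with q hq
  exact (hq.1.symm.trans hxy).trans hq.2

lemma tendsto_mul_inv_pow_rpow (hρ : 1 < ρ) {a : ℝ} (ha : 0 < a) (C : ℝ) :
    Tendsto (fun N : ℕ => C * ((ρ ^ N)⁻¹) ^ a) atTop (𝓝 0) := by
  have h1 : Tendsto (fun N : ℕ => (ρ ^ N)⁻¹) atTop (𝓝 0) :=
    tendsto_inv_atTop_zero.comp (tendsto_pow_atTop_atTop_of_one_lt hρ)
  have h2 := (h1.rpow_const (p := a) (Or.inr ha.le)).const_mul C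
  simpa [Real.zero_rpow ha.ne'] using h2

/-- Hölder maps for `d_ρ` are continuous for the product topology. -/
lemma continuous_of_dist_le_dOmega (hρ : 1 < ρ) {a C : ℝ} (ha : 0 < a) (hC : 0 ≤ C)
    {Y : Type*} [PseudoMetricSpace Y] {u : Omega P → Y}
    (h : ∀ x y, dist (u x) (u y) ≤ C * dOmega ρ x y ^ a) : Continuous u := by
  rw [continuous_iff_continuousAt]
  intro x
  rw [ContinuousAt, Metric.tendsto_nhds]
  intro ε hε
  obtain ⟨N, hN⟩ := ((tendsto_mul_inv_pow_rpow hρ ha C).eventually_lt_const hε).exists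
  filter_upwards [eventually_agreeBelow x N] with y hy
  refine (h y x).trans_lt (lt_of_le_of_lt ?_ hN)
  gcongr
  · exact dOmega_nonneg hρ _ _
  · exact dOmega_le_of_agree hρ hy.symm

lemma shift_apply (x : Omega P) (n : ℤ) : (shift P x).1 n = x.1 (n + 1) := rfl

lemma shift_symm_apply (x : Omega P) (n : ℤ) : ((shift P).symm x).1 n = x.1 (n - 1) := rfl

lemma shift_iterate_apply (m : ℕ) (x : Omega P) (n : ℤ) :
    ((shift P)^[m] x).1 n = x.1 (n + m) := by
  induction m generalizing n with
  | zero => simp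
  | succ m ih =>
    rw [Function.iterate_succ_apply', shift_apply, ih]
    exact congrArg x.1 (by push_cast; ring)

lemma shift_symm_iterate_apply (m : ℕ) (x : Omega P) (n : ℤ) :
    ((shift P).symm^[m] x).1 n = x.1 (n - m) := by
  induction m generalizing n with
  | zero => simp
  | succ m ih =>
    rw [Function.iterate_succ_apply', shift_symm_apply, ih]
    exact congrArg x.1 (by push_cast; ring)

lemma dOmega_shift_symm_le (hρ : 1 < ρ) (x y : Omega P) :
    dOmega ρ ((shift P).symm x) ((shift P).symm y) ≤ ρ * dOmega ρ x y := by
  refine dOmega_le_mul hρ (fun N h n hn => h _ ?_) fun h => by rw [h]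
  rw [abs_lt] at hn ⊢
  push_cast
  omega

lemma dOmega_shift_iterate_le (hρ : 1 < ρ) (h : y ∈ WsLoc x) (m : ℕ) :
    dOmega ρ ((shift P)^[m] x) ((shift P)^[m] y) ≤ dOmega ρ x y / ρ ^ m := by
  refine dOmega_le_div_pow hρ m (fun N hN n hn => ?_) fun h => by rw [h]
  rw [shift_iterate_apply, shift_iterate_apply]
  rw [abs_lt] at hn
  push_cast at hn
  rcases le_or_gt 0 (n + m) with h0 | h0
  · exact h _ h0
  · exact hN _ (by rw [abs_lt]; omega)

lemma dOmega_shift_symm_iterate_le (hρ : 1 < ρ) (h : y ∈ WuLoc x) (m : ℕ) :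
    dOmega ρ ((shift P).symm^[m] x) ((shift P).symm^[m] y) ≤ dOmega ρ x y / ρ ^ m := by
  refine dOmega_le_div_pow hρ m (fun N hN n hn => ?_) fun h => by rw [h]
  rw [shift_symm_iterate_apply, shift_symm_iterate_apply]
  rw [abs_lt] at hn
  push_cast at hn
  rcases le_or_gt (n - m) 0 with h0 | h0
  · exact h _ h0
  · exact hN _ (by rw [abs_lt]; omega)

/-- The orbits of `x` and `y` under `T` are exponentially asymptotic, at rate `ρ⁻¹` and with
constant `c`. -/
def Asymptotic (ρ : ℝ) (T : Omega P → Omega P) (c : ℝ) (x y : Omega P) : Prop :=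
  ∀ n : ℕ, dOmega ρ (T^[n] x) (T^[n] y) ≤ c / ρ ^ n

lemma Asymptotic.refl {T : Omega P → Omega P} (x : Omega P) :
    Asymptotic ρ T 0 x x := fun n => by simp [dOmega_self]

lemma dOmega_comm (ρ : ℝ) (x y : Omega P) : dOmega ρ x y = dOmega ρ y x := by
  by_cases h : x = y
  · rw [h]
  · simp only [dOmega, h, Ne.symm h, if_false, eq_comm]

lemma Asymptotic.symm {T : Omega P → Omega P} {c : ℝ} (h : Asymptotic ρ T c x y) :
    Asymptotic ρ T c y x := fun n => by rw [dOmega_comm]; exact h n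

lemma Asymptotic.map {T : Omega P → Omega P} {c : ℝ} (h : Asymptotic ρ T c x y) :
    Asymptotic ρ T (c / ρ) (T x) (T y) := fun n => by
  have := h (n + 1)
  rw [Function.iterate_succ_apply, Function.iterate_succ_apply] at this
  refine this.trans_eq ?_
  rw [pow_succ, div_div, mul_comm]

lemma asymptotic_of_mem_WsLoc (hρ : 1 < ρ) (h : y ∈ WsLoc x) :
    Asymptotic ρ (shift P) (dOmega ρ x y) x y := dOmega_shift_iterate_le hρ h

lemma asymptotic_of_mem_WuLoc (hρ : 1 < ρ) (h : y ∈ WuLoc x) :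
    Asymptotic ρ (shift P).symm (dOmega ρ x y) x y := dOmega_shift_symm_iterate_le hρ h

lemma pow_inv_sub_le (hρ : 1 < ρ) (m n : ℕ) : (ρ ^ (n - m))⁻¹ ≤ ρ ^ m / ρ ^ n := by
  have hρ0 : 0 < ρ := by linarith
  rw [le_div_iff₀ (by positivity), inv_mul_le_iff₀ (by positivity), ← pow_add]
  exact pow_le_pow_right₀ hρ.le (by omega)

lemma exists_asymptotic_of_mem_Ws (hρ : 1 < ρ) (h : y ∈ Ws x) :
    ∃ c, Asymptotic ρ (shift P) c x y := by
  obtain ⟨m, hm⟩ := h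
  refine ⟨ρ ^ m.toNat, fun n => le_trans (dOmega_le_of_agree hρ ?_) (pow_inv_sub_le hρ m.toNat n)⟩
  intro j hj
  rw [shift_iterate_apply, shift_iterate_apply]
  rw [abs_lt] at hj
  exact hm _ (by omega)

lemma exists_asymptotic_of_mem_Wu (hρ : 1 < ρ) (h : y ∈ Wu x) :
    ∃ c, Asymptotic ρ (shift P).symm c x y := by
  obtain ⟨m, hm⟩ := h
  refine ⟨ρ ^ (-m).toNat,
    fun n => le_trans (dOmega_le_of_agree hρ ?_) (pow_inv_sub_le hρ (-m).toNat n)⟩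
  intro j hj
  rw [shift_symm_iterate_apply, shift_symm_iterate_apply]
  rw [abs_lt] at hj
  exact hm _ (by omega)

end Distance

/-! ### Bunched cocycles and their holonomies -/

section Iterates

variable {X G : Type*} [TopologicalSpace G]

/-- The iterates `A_{T^{n-1}(x)} ∘ ⋯ ∘ A_x` of a cocycle `A` over an arbitrary map `T`. It is used
with `T` the shift and with `T` its inverse. -/
def iter (T : X → X) (A : X → G ≃ₜ G) : ℕ → X → G ≃ₜ G
  | 0, _ => 1
  | n + 1, x => A (T^[n] x) * iter T A n x

lemma iter_succ_apply (T : X → X) (A : X → G ≃ₜ G) (n : ℕ) (x : X) (p : G) :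
    iter T A (n + 1) x p = A (T^[n] x) (iter T A n x p) := rfl

lemma iter_succ' (T : X → X) (A : X → G ≃ₜ G) (n : ℕ) (x : X) :
    iter T A (n + 1) x = iter T A n (T x) * A x := by
  induction n with
  | zero => simp [iter]
  | succ n ih => rw [iter, ih, iter, Function.iterate_succ_apply, mul_assoc]

lemma iter_succ_apply' (T : X → X) (A : X → G ≃ₜ G) (n : ℕ) (x : X) (p : G) :
    iter T A (n + 1) x p = iter T A n (T x) (A x p) := by
  rw [iter_succ']; rfl

lemma iter_succ_symm_apply (T : X → X) (A : X → G ≃ₜ G) (n : ℕ) (x : X) (p : G) :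
    (iter T A (n + 1) x).symm p = (iter T A n x).symm ((A (T^[n] x)).symm p) := rfl

lemma iter_succ_symm_apply' (T : X → X) (A : X → G ≃ₜ G) (n : ℕ) (x : X) (p : G) :
    (iter T A (n + 1) x).symm p = (A x).symm ((iter T A n (T x)).symm p) := by
  rw [iter_succ']; rfl

/-- The continuous map `(A^n_y)⁻¹ ∘ A^n_x`, whose limit is the holonomy from `x` to `y`. -/
def holApprox (T : X → X) (A : X → G ≃ₜ G) (n : ℕ) (x y : X) : C(G, G) :=
  (((iter T A n y)⁻¹ * iter T A n x : G ≃ₜ G) : C(G, G))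

lemma holApprox_apply (T : X → X) (A : X → G ≃ₜ G) (n : ℕ) (x y : X) (p : G) :
    holApprox T A n x y p = (iter T A n y).symm (iter T A n x p) := rfl

/-- The holonomy `lim (A^n_y)⁻¹ ∘ A^n_x`; it has no meaning if this limit does not exist. -/
noncomputable def hol (T : X → X) (A : X → G ≃ₜ G) (x y : X) : C(G, G) :=
  @limUnder _ _ _ ⟨ContinuousMap.id G⟩ atTop fun n => holApprox T A n x y

end Iterates

section Bunched

variable {k : ℕ} {P : Matrix (Fin k) (Fin k) ℕ} {G : Type*} [MetricSpace G]

/-- The hypothesis under which a cocycle `A` over `T` has holonomies: `A` is `a`-Hölder for the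
uniform distance, and the iterates `A^n_x` and their inverses are Lipschitz with constant `M Λ^n`,
where `Λ < ρ^a` is less than the gain of the Hölder condition along asymptotic orbits. -/
structure IsBunched (ρ a : ℝ) (T : Omega P → Omega P) (A : Omega P → G ≃ₜ G) (C M Λ : ℝ) :
    Prop where
  one_lt : 1 < ρ
  exponent_pos : 0 < a
  C_nonneg : 0 ≤ C
  M_nonneg : 0 ≤ M
  rate_pos : 0 < Λ
  rate_lt : Λ < ρ ^ a
  dist_le : ∀ x y p, dist (A x p) (A y p) ≤ C * dOmega ρ x y ^ a
  iter_le : ∀ n x p q, dist (iter T A n x p) (iter T A n x q) ≤ M * Λ ^ n * dist p q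
  iter_symm_le : ∀ n x p q,
    dist ((iter T A n x).symm p) ((iter T A n x).symm q) ≤ M * Λ ^ n * dist p q

namespace IsBunched

variable {ρ a C M Λ c : ℝ} {T : Omega P → Omega P} {A : Omega P → G ≃ₜ G} {x y z : Omega P}

lemma apply_le (h : IsBunched ρ a T A C M Λ) (x : Omega P) (p q : G) :
    dist (A x p) (A x q) ≤ M * Λ * dist p q := by
  simpa [iter] using h.iter_le 1 x p q

lemma symm_apply_le (h : IsBunched ρ a T A C M Λ) (x : Omega P) (p q : G) :
    dist ((A x).symm p) ((A x).symm q) ≤ M * Λ * dist p q := by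
  simpa [iter] using h.iter_symm_le 1 x p q

lemma symm_dist_le (h : IsBunched ρ a T A C M Λ) (x y : Omega P) (p : G) :
    dist ((A x).symm p) ((A y).symm p) ≤ M * Λ * C * dOmega ρ x y ^ a := by
  have h1 := h.symm_apply_le y (A y ((A x).symm p)) (A x ((A x).symm p))
  have h2 := h.dist_le y x ((A x).symm p)
  rw [Homeomorph.symm_apply_apply, Homeomorph.apply_symm_apply] at h1
  rw [Homeomorph.apply_symm_apply, dOmega_comm] at h2
  have h3 : 0 ≤ M * Λ := mul_nonneg h.M_nonneg h.rate_pos.le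
  calc _ ≤ _ := h1
    _ ≤ M * Λ * (C * dOmega ρ x y ^ a) := by gcongr
    _ = _ := by ring

lemma continuous_apply (h : IsBunched ρ a T A C M Λ) :
    Continuous fun q : Omega P × G => A q.1 q.2 := by
  refine continuous_prod_of_continuous_lipschitzWith' _ (M * Λ).toNNReal
    (fun x => LipschitzWith.of_dist_le' fun p q => h.apply_le x p q) fun p => ?_
  exact continuous_of_dist_le_dOmega h.one_lt h.exponent_pos h.C_nonneg fun x y => h.dist_le x y p

lemma continuous_symm_apply (h : IsBunched ρ a T A C M Λ) :
    Continuous fun q : Omega P × G => (A q.1).symm q.2 := by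
  refine continuous_prod_of_continuous_lipschitzWith' _ (M * Λ).toNNReal
    (fun x => LipschitzWith.of_dist_le' fun p q => h.symm_apply_le x p q) fun p => ?_
  exact continuous_of_dist_le_dOmega h.one_lt h.exponent_pos
    (mul_nonneg (mul_nonneg h.M_nonneg h.rate_pos.le) h.C_nonneg) fun x y => h.symm_dist_le x y p

lemma continuous_iter (hT : Continuous T) (hA : Continuous fun q : Omega P × G => A q.1 q.2)
    (n : ℕ) : Continuous fun q : Omega P × G => iter T A n q.1 q.2 := by
  induction n with
  | zero => exact continuous_snd
  | succ n ih => exact hA.comp (((hT.iterate n).comp continuous_fst).prodMk ih)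

lemma continuous_iter_symm (hT : Continuous T)
    (hA : Continuous fun q : Omega P × G => (A q.1).symm q.2)
    (n : ℕ) : Continuous fun q : Omega P × G => (iter T A n q.1).symm q.2 := by
  induction n with
  | zero => exact continuous_snd
  | succ n ih =>
    exact ih.comp (continuous_fst.prodMk
      (hA.comp (((hT.iterate n).comp continuous_fst).prodMk continuous_snd)))

lemma ratio_pos (h : IsBunched ρ a T A C M Λ) : 0 < Λ / ρ ^ a :=
  div_pos h.rate_pos (h.rate_pos.trans h.rate_lt)

lemma ratio_lt_one (h : IsBunched ρ a T A C M Λ) : Λ / ρ ^ a < 1 :=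
  (div_lt_one (h.rate_pos.trans h.rate_lt)).2 h.rate_lt

lemma dist_holApprox_apply_le (h : IsBunched ρ a T A C M Λ) (n : ℕ) (x y : Omega P) (p q : G) :
    dist (holApprox T A n x y p) (holApprox T A n x y q) ≤ M ^ 2 * (Λ ^ n) ^ 2 * dist p q := by
  have hM := h.M_nonneg
  have hΛ := h.rate_pos
  calc _ ≤ _ := h.iter_symm_le _ _ _ _
    _ ≤ M * Λ ^ n * (M * Λ ^ n * dist p q) := by gcongr; exact h.iter_le _ _ _ _
    _ = _ := by ring

variable [CompactSpace G]

/-- The increment is `(A^n_y)⁻¹ ∘ A_{T^n y}⁻¹` applied to the discrepancy of `A_{T^n x}` and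
`A_{T^n y}`. The expansion `Λ^n` of the first factor is beaten by the `a`-Hölder bound
`ρ ^ (-a n)` on the second. -/
lemma dist_holApprox_succ_le (h : IsBunched ρ a T A C M Λ) (hc : 0 ≤ c)
    (hxy : Asymptotic ρ T c x y) (n : ℕ) :
    dist (holApprox T A n x y) (holApprox T A (n + 1) x y) ≤
      M * Λ * C * c ^ a * (Λ / ρ ^ a) ^ n := by
  have hρ0 : 0 < ρ := by linarith [h.one_lt]
  have hM := h.M_nonneg
  have hΛ := h.rate_pos
  have hC := h.C_nonneg
  refine (ContinuousMap.dist_le (by positivity)).2 fun p => ?_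
  rw [holApprox_apply, holApprox_apply, iter_succ_apply]
  set q := iter T A n x p
  have h1 : (iter T A n y).symm q = (iter T A (n + 1) y).symm (A (T^[n] y) q) := by
    rw [iter_succ_symm_apply, Homeomorph.symm_apply_apply]
  rw [h1]
  calc _ ≤ _ := h.iter_symm_le _ _ _ _
    _ ≤ M * Λ ^ (n + 1) * (C * (c / ρ ^ n) ^ a) := by
      have h2 := h.dist_le (T^[n] y) (T^[n] x) q
      rw [dOmega_comm] at h2
      have h3 := Real.rpow_le_rpow (dOmega_nonneg h.one_lt _ _) (hxy n) h.exponent_pos.le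
      exact mul_le_mul_of_nonneg_left
        (h2.trans (mul_le_mul_of_nonneg_left h3 hC)) (by positivity)
    _ = _ := by
      rw [Real.div_rpow hc (by positivity), ← Real.rpow_natCast ρ n, ← Real.rpow_mul hρ0.le,
        mul_comm (n : ℝ) a, Real.rpow_mul hρ0.le, Real.rpow_natCast, div_pow, pow_succ]
      ring

lemma tendsto_hol (h : IsBunched ρ a T A C M Λ) (hc : 0 ≤ c) (hxy : Asymptotic ρ T c x y) :
    Tendsto (fun n => holApprox T A n x y) atTop (𝓝 (hol T A x y)) := by
  have : CauchySeq fun n => holApprox T A n x y :=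
    cauchySeq_of_le_geometric _ _ h.ratio_lt_one (h.dist_holApprox_succ_le hc hxy)
  exact this.tendsto_limUnder

lemma tendsto_hol_apply (h : IsBunched ρ a T A C M Λ) (hc : 0 ≤ c) (hxy : Asymptotic ρ T c x y)
    (p : G) : Tendsto (fun n => (iter T A n y).symm (iter T A n x p)) atTop (𝓝 (hol T A x y p)) :=
  ((continuous_eval_const p).tendsto _).comp (h.tendsto_hol hc hxy)

lemma dist_holApprox_hol_le (h : IsBunched ρ a T A C M Λ) (hc : 0 ≤ c)
    (hxy : Asymptotic ρ T c x y) (n : ℕ) :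
    dist (holApprox T A n x y) (hol T A x y) ≤
      M * Λ * C / (1 - Λ / ρ ^ a) * c ^ a * (Λ / ρ ^ a) ^ n := by
  refine (dist_le_of_le_geometric_of_tendsto _ _ h.ratio_lt_one (h.dist_holApprox_succ_le hc hxy)
    (h.tendsto_hol hc hxy) n).trans_eq ?_
  ring

lemma dist_hol_le (h : IsBunched ρ a T A C M Λ) (hc : 0 ≤ c)
    (hxy : Asymptotic ρ T c x y) (p : G) :
    dist (hol T A x y p) p ≤ M * Λ * C / (1 - Λ / ρ ^ a) * c ^ a := by
  have h1 := h.dist_holApprox_hol_le hc hxy 0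
  rw [pow_zero, mul_one, dist_comm] at h1
  exact (ContinuousMap.dist_apply_le_dist p).trans h1

lemma hol_self (h : IsBunched ρ a T A C M Λ) (x : Omega P) : hol T A x x = ContinuousMap.id G := by
  refine tendsto_nhds_unique (h.tendsto_hol le_rfl (Asymptotic.refl x)) ?_
  refine tendsto_const_nhds.congr fun n => ?_
  ext p
  simp [holApprox_apply]

lemma hol_comp (h : IsBunched ρ a T A C M Λ) {c₁ c₂ c₃ : ℝ} (h₁ : 0 ≤ c₁) (h₂ : 0 ≤ c₂)
    (h₃ : 0 ≤ c₃) (hxy : Asymptotic ρ T c₁ x y) (hyz : Asymptotic ρ T c₂ y z)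
    (hxz : Asymptotic ρ T c₃ x z) : (hol T A y z).comp (hol T A x y) = hol T A x z := by
  refine tendsto_nhds_unique ((h.tendsto_hol h₂ hyz).compCM (h.tendsto_hol h₁ hxy))
    ((h.tendsto_hol h₃ hxz).congr fun n => ?_)
  ext p
  simp [holApprox_apply]

lemma hol_hol_symm (h : IsBunched ρ a T A C M Λ) (hc : 0 ≤ c) (hxy : Asymptotic ρ T c x y)
    (p : G) : hol T A y x (hol T A x y p) = p := by
  have h1 := h.hol_comp hc hc le_rfl hxy hxy.symm (Asymptotic.refl x)
  rw [h.hol_self] at h1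
  exact DFunLike.congr_fun h1 p

lemma hol_equivariant (h : IsBunched ρ a T A C M Λ) (hc : 0 ≤ c) (hxy : Asymptotic ρ T c x y)
    (p : G) : A y (hol T A x y p) = hol T A (T x) (T y) (A x p) := by
  have h1 := ((A y).continuous.tendsto _).comp
    ((h.tendsto_hol_apply hc hxy p).comp (tendsto_add_atTop_nat 1))
  have hρ0 : 0 < ρ := by linarith [h.one_lt]
  refine tendsto_nhds_unique h1 ((h.tendsto_hol_apply (c := c / ρ) (by positivity)
    hxy.map (A x p)).congr fun n => ?_)
  simp only [Function.comp_apply]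
  rw [iter_succ_symm_apply', iter_succ_apply', Homeomorph.apply_symm_apply]

/-- The holonomies are jointly continuous where the convergence is uniform. -/
lemma continuousOn_hol (h : IsBunched ρ a T A C M Λ) (hT : Continuous T) (hc : 0 ≤ c)
    {S : Set (Omega P × Omega P × G)} (hS : ∀ q ∈ S, Asymptotic ρ T c q.1 q.2.1) :
    ContinuousOn (fun q : Omega P × Omega P × G => hol T A q.1 q.2.1 q.2.2) S := by
  set K := M * Λ * C / (1 - Λ / ρ ^ a) * c ^ a
  have ht : Tendsto (fun n : ℕ => K * (Λ / ρ ^ a) ^ n) atTop (𝓝 0) := by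
    simpa using (tendsto_pow_atTop_nhds_zero_of_lt_one h.ratio_pos.le h.ratio_lt_one).const_mul K
  have hu : TendstoUniformlyOn
      (fun (n : ℕ) (q : Omega P × Omega P × G) => holApprox T A n q.1 q.2.1 q.2.2)
      (fun q => hol T A q.1 q.2.1 q.2.2) atTop S := by
    rw [Metric.tendstoUniformlyOn_iff]
    intro ε hε
    filter_upwards [ht.eventually_lt_const hε] with n hn q hq
    rw [dist_comm]
    exact ((ContinuousMap.dist_apply_le_dist _).trans
      (h.dist_holApprox_hol_le hc (hS q hq) n)).trans_lt hn
  refine hu.continuousOn (Frequently.of_forall fun n => Continuous.continuousOn ?_)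
  exact (continuous_iter_symm hT h.continuous_symm_apply n).comp
    ((continuous_fst.comp continuous_snd).prodMk
      ((continuous_iter hT h.continuous_apply n).comp
        (continuous_fst.prodMk (continuous_snd.comp continuous_snd))))

/-- Without expansion the holonomies are Lipschitz. -/
lemma hol_lipschitz (h : IsBunched ρ a T A C M 1) (hc : 0 ≤ c) (hxy : Asymptotic ρ T c x y)
    (p q : G) : dist (hol T A x y p) (hol T A x y q) ≤ M ^ 2 * dist p q := by
  refine le_of_tendsto ((h.tendsto_hol_apply hc hxy p).dist (h.tendsto_hol_apply hc hxy q))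
    (Eventually.of_forall fun n => ?_)
  simpa [holApprox_apply] using h.dist_holApprox_apply_le n x y p q

/-- If the expansion is `ρ ^ (a - θ)`, the holonomies are `θ / 2`-Hölder: at distance `d ≈ ρ^{-2n}`,
replacing the holonomy by its `n`-th approximation costs `ρ^{-θ n} ≈ d ^ (θ / 2)`, and the
approximation, being Lipschitz with constant `ρ ^ (2 (a - θ) n)`, contributes at most
`d ^ (1 - a + θ)`. -/
lemma exists_holder_hol {θ : ℝ} (hθ : 0 < θ) (hθa : θ ≤ a) (ha1 : a ≤ 1)
    (h : IsBunched ρ a T A C M (ρ ^ (a - θ))) (hc : 0 ≤ c) :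
    ∃ B : ℝ, 0 ≤ B ∧ ∀ x y, Asymptotic ρ T c x y → ∀ p q,
      dist (hol T A x y p) (hol T A x y q) ≤ B * dist p q ^ (θ / 2) := by
  have hρ := h.one_lt
  have hρ0 : 0 < ρ := by linarith
  have hM := h.M_nonneg
  have hC := h.C_nonneg
  have hτ : ρ ^ (a - θ) / ρ ^ a = ρ ^ (-θ) := by
    rw [← Real.rpow_sub hρ0]; ring_nf
  have hτ1 := h.ratio_lt_one
  set K := M * ρ ^ (a - θ) * C / (1 - ρ ^ (a - θ) / ρ ^ a) * c ^ a with hK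
  have hK0 : 0 ≤ K := by
    have : 0 < 1 - ρ ^ (a - θ) / ρ ^ a := by linarith
    positivity
  set Δ := Metric.diam (Set.univ : Set G)
  have hΔ0 : 0 ≤ Δ := Metric.diam_nonneg
  have hΔ : ∀ p q : G, dist p q ≤ Δ := fun p q =>
    Metric.dist_le_diam_of_mem isCompact_univ.isBounded trivial trivial
  refine ⟨2 * K * ρ ^ θ + M ^ 2 + Δ, by positivity, fun x y hxy p q => ?_⟩
  set d := dist p q with hd
  have hd0 : 0 ≤ d := dist_nonneg
  rcases hd0.eq_or_lt with hd00 | hdpos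
  · rw [← hd00, dist_eq_zero.1 hd00.symm, dist_self]
    positivity
  rcases le_or_gt 1 d with hd1 | hd1
  · have h1 : 1 ≤ d ^ (θ / 2) := Real.one_le_rpow hd1 (by positivity)
    calc dist (hol T A x y p) (hol T A x y q) ≤ Δ * 1 := by rw [mul_one]; exact hΔ _ _
      _ ≤ _ := by
        gcongr
        have : 0 ≤ 2 * K * ρ ^ θ + M ^ 2 := by positivity
        linarith
  · obtain ⟨n, hn1, hn2⟩ := exists_nat_pow_near (one_le_inv₀ hdpos |>.2 hd1.le)
      (show 1 < ρ ^ 2 by nlinarith)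
    have hcast : ∀ t : ℝ, (ρ ^ t) ^ n = ((ρ ^ 2) ^ n) ^ (t / 2) := by
      intro t
      rw [← Real.rpow_natCast (ρ ^ t), ← Real.rpow_mul hρ0.le, ← pow_mul,
        ← Real.rpow_natCast ρ (2 * n), ← Real.rpow_mul hρ0.le]
      push_cast
      ring_nf
    -- the error of the approximation
    have herr : ∀ p : G, dist (holApprox T A n x y p) (hol T A x y p) ≤
        K * (ρ ^ θ * d ^ (θ / 2)) := by
      intro p
      refine (ContinuousMap.dist_apply_le_dist p).trans
        ((h.dist_holApprox_hol_le hc hxy n).trans ?_)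
      rw [← hK]
      refine mul_le_mul_of_nonneg_left ?_ hK0
      have h2 : (d⁻¹) ^ (θ / 2) ≤ ((ρ ^ 2) ^ (n + 1)) ^ (θ / 2) :=
        Real.rpow_le_rpow (by positivity) hn2.le (by positivity)
      have h3 : ((ρ ^ 2) ^ (n + 1)) ^ (θ / 2) = (ρ ^ θ) ^ n * ρ ^ θ := by
        rw [← pow_succ, ← Real.rpow_natCast (ρ ^ θ), ← Real.rpow_mul hρ0.le, ← pow_mul,
          ← Real.rpow_natCast ρ, ← Real.rpow_mul hρ0.le]
        push_cast
        ring_nf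
      rw [h3, Real.inv_rpow hd0] at h2
      rw [hτ, Real.rpow_neg hρ0.le, inv_pow]
      rw [inv_le_iff_one_le_mul₀ (by positivity)] at h2 ⊢
      linarith
    -- the Lipschitz constant of the approximation
    have hlip : (( ρ ^ (a - θ)) ^ n) ^ 2 * d ≤ d ^ (θ / 2) := by
      rw [← pow_mul, mul_comm n 2, pow_mul, ← Real.rpow_natCast (ρ ^ (a - θ)) 2,
        ← Real.rpow_mul hρ0.le, hcast]
      have h4 : ((ρ ^ 2) ^ n) ^ (((a - θ) * (2 : ℕ)) / 2) ≤ (d⁻¹) ^ (a - θ) := by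
        rw [show ((a - θ) * (2 : ℕ)) / 2 = a - θ by push_cast; ring]
        exact Real.rpow_le_rpow (by positivity) hn1 (by linarith)
      calc _ ≤ (d⁻¹) ^ (a - θ) * d := by gcongr
        _ = d ^ (1 - (a - θ)) := by
          rw [Real.inv_rpow hd0, Real.rpow_sub hdpos 1, Real.rpow_one]
          field_simp
        _ ≤ d ^ (θ / 2) := Real.rpow_le_rpow_of_exponent_ge hdpos hd1.le (by linarith)
    have h5 := h.dist_holApprox_apply_le n x y p q
    have h6 : M ^ 2 * ((ρ ^ (a - θ)) ^ n) ^ 2 * d ≤ M ^ 2 * d ^ (θ / 2) := by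
      rw [mul_assoc]; gcongr
    have h7 := dist_triangle4 (hol T A x y p) (holApprox T A n x y p) (holApprox T A n x y q)
      (hol T A x y q)
    rw [dist_comm (hol T A x y p) (holApprox T A n x y p)] at h7
    have h8 : 0 ≤ Δ * d ^ (θ / 2) := by positivity
    nlinarith [herr p, herr q]

end IsBunched

end Bunched

/-! ### Time reversal and existence of the holonomies -/

section Reversal

variable {k : ℕ} {P : Matrix (Fin k) (Fin k) ℕ} {G : Type*}

lemma iterNat_eq_iter [TopologicalSpace G] (f : Omega P → G ≃ₜ G) (n : ℕ) (x : Omega P) :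
    iterNat f n x = iter (shift P) f n x := by
  induction n with
  | zero => rfl
  | succ n ih => rw [iterNat, iter, ih]

/-- The time reversal `x ↦ (A_{σ⁻¹ x})⁻¹`, a cocycle over `σ⁻¹`. The unstable holonomies of `A` are
the stable ones of its time reversal. -/
def reversal [TopologicalSpace G] (A : Omega P → G ≃ₜ G) (x : Omega P) : G ≃ₜ G :=
  (A ((shift P).symm x))⁻¹

lemma iter_reversal [TopologicalSpace G] (A : Omega P → G ≃ₜ G) (n : ℕ) (x : Omega P) :
    iter (shift P).symm (reversal A) n x = (iter (shift P) A n ((shift P).symm^[n] x))⁻¹ := by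
  induction n with
  | zero => simp [iter]
  | succ n ih =>
    rw [iter, ih, iter_succ', mul_inv_rev, Function.iterate_succ_apply',
      Homeomorph.apply_symm_apply, reversal]

lemma iterInt_natCast [TopologicalSpace G] (f : Omega P → G ≃ₜ G) (n : ℕ) (x : Omega P) :
    iterInt f (n : ℤ) x = iter (shift P) f n x := iterNat_eq_iter f n x

lemma iterInt_neg_natCast [TopologicalSpace G] (f : Omega P → G ≃ₜ G) (n : ℕ) (x : Omega P) :
    iterInt f (-(n : ℤ)) x = iter (shift P).symm (reversal f) n x := by
  rcases n with - | n
  · rfl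
  · rw [iter_reversal, ← iterNat_eq_iter]
    rfl

variable [MetricSpace G] {ρ a C M Λ : ℝ}

lemma IsBunched.reversal {A : Omega P → G ≃ₜ G} (h : IsBunched ρ a (shift P) A C M Λ) :
    IsBunched ρ a (shift P).symm (reversal A) (M * Λ * C * ρ ^ a) M Λ where
  one_lt := h.one_lt
  exponent_pos := h.exponent_pos
  C_nonneg := by
    have := h.one_lt
    have := h.C_nonneg
    have := h.M_nonneg
    have := h.rate_pos
    positivity
  M_nonneg := h.M_nonneg
  rate_pos := h.rate_pos
  rate_lt := h.rate_lt
  dist_le x y p := by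
    have hρ := h.one_lt
    have h1 := h.C_nonneg
    have h2 := h.M_nonneg
    have h3 := h.rate_pos
    calc _ ≤ _ := h.symm_dist_le ((shift P).symm x) ((shift P).symm y) p
      _ ≤ M * Λ * C * (ρ * dOmega ρ x y) ^ a := by
        gcongr
        · exact dOmega_nonneg hρ _ _
        · exact h.exponent_pos.le
        · exact dOmega_shift_symm_le hρ x y
      _ = _ := by rw [Real.mul_rpow (by linarith) (dOmega_nonneg hρ _ _)]; ring
  iter_le n x p q := by rw [iter_reversal]; exact h.iter_symm_le n _ p q
  iter_symm_le n x p q := by rw [iter_reversal]; exact h.iter_le n _ p q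

end Reversal

section LipschitzBounds

variable {G : Type*} [MetricSpace G]

lemma dist_le_of_lipConst_lt [AddGroup G] {u : G → G} {r : ℝ} (hr : 0 ≤ r)
    (h : lipConst u < ENNReal.ofReal r) (p q : G) : dist (u p) (u q) ≤ r * dist p q := by
  simp only [lipConst, eHolderNorm, iInf_lt_iff] at h
  obtain ⟨C, hC, hlt⟩ := h
  have h1 := (holderWith_one.1 hC).dist_le_mul p q
  refine h1.trans (mul_le_mul_of_nonneg_right ?_ dist_nonneg)
  have h2 := ENNReal.toReal_mono ENNReal.ofReal_ne_top hlt.le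
  rwa [ENNReal.toReal_ofReal hr] at h2

lemma holderWith_of_dist_le {u : G → G} {B : ℝ} (hB : 0 ≤ B) {r : ℝ≥0}
    (h : ∀ p q, dist (u p) (u q) ≤ B * dist p q ^ (r : ℝ)) : HolderWith B.toNNReal r u := by
  intro p q
  have h1 := ENNReal.ofReal_le_ofReal (h p q)
  rw [ENNReal.ofReal_mul hB, ← ENNReal.ofReal_rpow_of_nonneg dist_nonneg r.coe_nonneg,
    ← edist_dist, ← edist_dist] at h1
  exact h1

/-- On a compact space a Hölder exponent can be lowered, with a constant depending only on the
original one. -/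
lemma exists_holderWith_of_le [CompactSpace G] {r s : ℝ≥0} (hsr : s ≤ r) (B : ℝ≥0) :
    ∃ B' : ℝ≥0, ∀ u : G → G, HolderWith B r u → HolderWith B' s u := by
  have hb : ∀ x y : G, edist x y ≤ (Metric.diam (Set.univ : Set G)).toNNReal := by
    intro x y
    rw [edist_dist]
    exact ENNReal.ofReal_le_ofReal
      (Metric.dist_le_diam_of_mem isCompact_univ.isBounded trivial trivial)
  exact ⟨_, fun u hu => hu.of_le hb hsr⟩

variable {k : ℕ} {P : Matrix (Fin k) (Fin k) ℕ}

lemma iter_le_pow {T : Omega P → Omega P} {A : Omega P → G ≃ₜ G} {Λ : ℝ} (hΛ : 0 ≤ Λ)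
    (h : ∀ x p q, dist (A x p) (A x q) ≤ Λ * dist p q) (n : ℕ) (x : Omega P) (p q : G) :
    dist (iter T A n x p) (iter T A n x q) ≤ Λ ^ n * dist p q := by
  induction n with
  | zero => simp [iter]
  | succ n ih =>
    calc _ ≤ _ := h _ _ _
      _ ≤ Λ * (Λ ^ n * dist p q) := mul_le_mul_of_nonneg_left ih hΛ
      _ = _ := by ring

lemma iter_symm_le_pow {T : Omega P → Omega P} {A : Omega P → G ≃ₜ G} {Λ : ℝ} (hΛ : 0 ≤ Λ)
    (h : ∀ x p q, dist ((A x).symm p) ((A x).symm q) ≤ Λ * dist p q) (n : ℕ) (x : Omega P)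
    (p q : G) :
    dist ((iter T A n x).symm p) ((iter T A n x).symm q) ≤ Λ ^ n * dist p q := by
  induction n generalizing p q with
  | zero => exact (one_mul (dist p q)).symm.le.trans_eq (by rw [pow_zero])
  | succ n ih =>
    calc _ ≤ _ := ih _ _
      _ ≤ Λ ^ n * (Λ * dist p q) := by gcongr; exact h _ _ _
      _ = _ := by ring

variable [AddGroup G] {ρ : ℝ} {α : ℝ≥0} {θ : ℝ}

lemma IsHolderCocycle.exists_dist_le {f : Omega P → G ≃ₜ G} (hρ : 1 < ρ)
    (hf : IsHolderCocycle ρ α f) :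
    ∃ C : ℝ, 0 ≤ C ∧ ∀ x y p, dist (f x p) (f y p) ≤ C * dOmega ρ x y ^ (α : ℝ) := by
  obtain ⟨-, C, hC⟩ := hf
  refine ⟨C, C.coe_nonneg, fun x y p => ?_⟩
  have h1 : edist (f x p) (f y p) ≤ dLip (f x) (f y) :=
    (le_iSup (fun p => edist (f x p) (f y p)) p).trans le_self_add
  have h2 := h1.trans (hC x y)
  have h0 : 0 ≤ dOmega ρ x y ^ (α : ℝ) := Real.rpow_nonneg (dOmega_nonneg hρ x y) _
  rw [edist_dist, ← ENNReal.ofReal_coe_nnreal, ← ENNReal.ofReal_mul C.coe_nonneg,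
    ENNReal.ofReal_le_ofReal_iff (by positivity)] at h2
  exact h2

lemma exists_isBunched_of_isSUDominatedWith {f : Omega P → G ≃ₜ G} (hρ : 1 < ρ) (hα : 0 < α)
    (hf : IsHolderCocycle ρ α f) (hd : IsSUDominatedWith ρ α θ f) {θ' : ℝ} (hθ' : 0 < θ')
    (hle : θ' ≤ θ) :
    ∃ C, IsBunched ρ (α : ℝ) (shift P) f C 1 (ρ ^ ((α : ℝ) - θ')) := by
  have hρ0 : 0 < ρ := by linarith
  obtain ⟨C, hC, hdist⟩ := hf.exists_dist_le hρ
  have hmono : ρ ^ ((α : ℝ) - θ) ≤ ρ ^ ((α : ℝ) - θ') :=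
    Real.rpow_le_rpow_of_exponent_le hρ.le (by linarith)
  have h0 : 0 ≤ ρ ^ ((α : ℝ) - θ') := by positivity
  refine ⟨C, hρ, by exact_mod_cast hα, hC, zero_le_one, by positivity, ?_, hdist, ?_, ?_⟩
  · exact Real.rpow_lt_rpow_of_exponent_lt hρ (by linarith)
  · intro n x p q
    rw [one_mul]
    exact iter_le_pow h0 (fun x p q => dist_le_of_lipConst_lt h0
      ((hd.2 x).trans_le (ENNReal.ofReal_le_ofReal hmono)) p q) n x p q
  · intro n x p q
    rw [one_mul]
    exact iter_symm_le_pow h0 (fun x p q => dist_le_of_lipConst_lt h0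
      ((hd.1 x).trans_le (ENNReal.ofReal_le_ofReal hmono)) p q) n x p q

lemma forall_of_ae_of_isClosed {X : Type*} [TopologicalSpace X] [MeasurableSpace X]
    {μ : Measure X} [μ.IsOpenPosMeasure] {p : X → Prop} (hp : IsClosed {x | p x})
    (h : ∀ᵐ x ∂μ, p x) (x : X) : p x := by
  have h1 : closure {x | p x} = Set.univ := (Measure.dense_of_ae h).closure_eq
  rw [hp.closure_eq] at h1
  exact h1.ge trivial

/-- By continuity and full support, the bounded distortion inequalities hold at every point. -/
lemma exists_isBunched_of_hasBoundedDistortion {g : Omega P → G ≃ₜ G} (hρ : 1 < ρ) (hα : 0 < α)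
    {μ : Measure (Omega P)} [μ.IsOpenPosMeasure]
    (hg : IsHolderCocycle ρ α g) (hd : HasBoundedDistortion μ g) :
    ∃ C M, IsBunched ρ (α : ℝ) (shift P) g C M 1 := by
  obtain ⟨C, hC, hdist⟩ := hg.exists_dist_le hρ
  obtain ⟨K, hK⟩ := hd
  have hα' : (0 : ℝ) < α := by exact_mod_cast hα
  have hcx : ∀ p, Continuous fun x => g x p := fun p =>
    continuous_of_dist_le_dOmega hρ hα' hC fun x y => hdist x y p
  have hlt : ∀ {u : G → G}, lipConst u < K → ∀ p q, dist (u p) (u q) ≤ K * dist p q :=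
    fun h => dist_le_of_lipConst_lt K.coe_nonneg (by rwa [ENNReal.ofReal_coe_nnreal])
  have hae : ∀ n, ∀ᵐ x ∂μ, (∀ p q, dist (iter (shift P) g n x p) (iter (shift P) g n x q) ≤
      K * dist p q) ∧ ∀ p q, dist p q ≤
      K * dist (iter (shift P) g n x p) (iter (shift P) g n x q) := by
    intro n
    filter_upwards [hK n] with x hx
    rw [iterNat_eq_iter] at hx
    refine ⟨hlt hx.1, fun p q => ?_⟩
    simpa using hlt hx.2 (iter (shift P) g n x p) (iter (shift P) g n x q)
  have hcg : Continuous fun q : Omega P × G => g q.1 q.2 := by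
    refine continuous_prod_of_continuous_lipschitzWith' _ K (fun x => ?_) hcx
    refine LipschitzWith.of_dist_le_mul fun p q => ?_
    refine forall_of_ae_of_isClosed (μ := μ)
      (isClosed_le ((hcx p).dist (hcx q)) continuous_const) ?_ x
    filter_upwards [hae 1] with x hx
    exact hx.1 p q
  have hci : ∀ n p, Continuous fun x => iter (shift P) g n x p := fun n p =>
    (IsBunched.continuous_iter (shift P).continuous hcg n).comp
      (continuous_id.prodMk continuous_const)
  have hall : ∀ n x, (∀ p q, dist (iter (shift P) g n x p) (iter (shift P) g n x q) ≤
      K * dist p q) ∧ ∀ p q, dist p q ≤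
      K * dist (iter (shift P) g n x p) (iter (shift P) g n x q) := by
    refine fun n x => ⟨fun p q => ?_, fun p q => ?_⟩
    · exact forall_of_ae_of_isClosed
        (isClosed_le ((hci n p).dist (hci n q)) continuous_const)
        ((hae n).mono fun x hx => hx.1 p q) x
    · exact forall_of_ae_of_isClosed
        (isClosed_le continuous_const (continuous_const.mul ((hci n p).dist (hci n q))))
        ((hae n).mono fun x hx => hx.2 p q) x
  refine ⟨C, K, hρ, hα', hC, K.coe_nonneg, zero_lt_one, Real.one_lt_rpow hρ hα', hdist, ?_, ?_⟩
  · intro n x p q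
    simpa using (hall n x).1 p q
  · intro n x p q
    simpa using (hall n x).2 ((iter (shift P) g n x).symm p) ((iter (shift P) g n x).symm q)

end LipschitzBounds

section Existence

variable {k : ℕ} {P : Matrix (Fin k) (Fin k) ℕ} {ρ : ℝ} {x y z : Omega P}

lemma Asymptotic.mono {T : Omega P → Omega P} {c c' : ℝ} (hρ : 1 < ρ)
    (h : Asymptotic ρ T c x y) (hc : c ≤ c') : Asymptotic ρ T c' x y := fun n => by
  refine (h n).trans ?_
  have : 0 < ρ := by linarith
  gcongr

lemma Asymptotic.nonneg {T : Omega P → Omega P} {c : ℝ} (hρ : 1 < ρ)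
    (h : Asymptotic ρ T c x y) : 0 ≤ c := by
  simpa using (dOmega_nonneg hρ _ _).trans (h 0)

lemma asymptotic_one_of_mem_WsLoc (hρ : 1 < ρ) (h : y ∈ WsLoc x) :
    Asymptotic ρ (shift P) 1 x y :=
  (asymptotic_of_mem_WsLoc hρ h).mono hρ (dOmega_le_one hρ x y)

lemma asymptotic_one_of_mem_WuLoc (hρ : 1 < ρ) (h : y ∈ WuLoc x) :
    Asymptotic ρ (shift P).symm 1 x y :=
  (asymptotic_of_mem_WuLoc hρ h).mono hρ (dOmega_le_one hρ x y)

lemma mem_Ws_of_mem_of_mem (hy : y ∈ Ws x) (hz : z ∈ Ws x) : z ∈ Ws y := by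
  obtain ⟨m, hm⟩ := hy
  obtain ⟨m', hm'⟩ := hz
  exact ⟨max m m', fun n hn => (hm n (le_of_max_le_left hn)).symm.trans
    (hm' n (le_of_max_le_right hn))⟩

lemma mem_Wu_of_mem_of_mem (hy : y ∈ Wu x) (hz : z ∈ Wu x) : z ∈ Wu y := by
  obtain ⟨m, hm⟩ := hy
  obtain ⟨m', hm'⟩ := hz
  exact ⟨min m m', fun n hn => (hm n (hn.trans (min_le_left _ _))).symm.trans
    (hm' n (hn.trans (min_le_right _ _)))⟩

variable {G : Type*} [MetricSpace G] [CompactSpace G]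

lemma isHolonomy_hol {a C M Λ : ℝ} {T : Omega P → Omega P} {A f : Omega P → G ≃ₜ G}
    {W Wloc : Omega P → Set (Omega P)} {l : Filter ℤ} {γ B : ℝ≥0}
    (h : IsBunched ρ a T A C M Λ) (hT : Continuous T)
    (hW : ∀ x, ∀ y ∈ W x, ∃ c, Asymptotic ρ T c x y)
    (hWW : ∀ x, ∀ y ∈ W x, ∀ z ∈ W x, z ∈ W y)
    (hWloc : ∀ x, ∀ y ∈ Wloc x, Asymptotic ρ T 1 x y)
    (hl : ∀ x y (u : C(G, G)), Tendsto (fun n => holApprox T A n x y) atTop (𝓝 u) →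
      Tendsto (fun n : ℤ => (((iterInt f n y)⁻¹ * iterInt f n x : G ≃ₜ G) : C(G, G))) l (𝓝 u))
    (he : ∀ x, ∀ y ∈ W x, ∀ p, f y (hol T A x y p) = hol T A (shift P x) (shift P y) (f x p))
    (hB : ∀ x y, Asymptotic ρ T 1 x y → HolderWith B γ (hol T A x y)) :
    IsHolonomy f W Wloc l γ (hol T A) where
  limit x y hy := by
    obtain ⟨c, hc⟩ := hW x y hy
    exact hl x y _ (h.tendsto_hol (hc.nonneg h.one_lt) hc)
  refl x := h.hol_self x
  comp x y hy z hz := by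
    obtain ⟨c₁, h₁⟩ := hW x y hy
    obtain ⟨c₂, h₂⟩ := hW y z (hWW x y hy z hz)
    obtain ⟨c₃, h₃⟩ := hW x z hz
    exact h.hol_comp (h₁.nonneg h.one_lt) (h₂.nonneg h.one_lt) (h₃.nonneg h.one_lt) h₁ h₂ h₃
  equivariant := he
  continuous := h.continuousOn_hol hT zero_le_one fun q hq => hWloc _ _ hq
  holder := ⟨B, fun x y hy => hB x y (hWloc x y hy)⟩

lemma tendsto_int_atTop_iff {Y : Type*} {u : ℤ → Y} {l : Filter Y} :
    Tendsto u atTop l ↔ Tendsto (fun n : ℕ => u n) atTop l := by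
  rw [← Nat.map_cast_int_atTop, tendsto_map'_iff]
  rfl

lemma tendsto_int_atBot_iff {Y : Type*} {u : ℤ → Y} {l : Filter Y} :
    Tendsto u atBot l ↔ Tendsto (fun n : ℕ => u (-n)) atTop l := by
  rw [← tendsto_int_atTop_iff (u := fun n => u (-n)), ← map_neg_atTop, tendsto_map'_iff]
  rfl

lemma IsBunched.exists_holderWith_hol {α γ : ℝ≥0} {θ C : ℝ} {T : Omega P → Omega P}
    {A : Omega P → G ≃ₜ G} (h : IsBunched ρ (α : ℝ) T A C 1 (ρ ^ ((α : ℝ) - θ)))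
    (hα1 : α ≤ 1) (hθ : 0 < θ) (hθα : θ ≤ α) (hγ : (γ : ℝ) ≤ θ / 2) :
    ∃ B : ℝ≥0, ∀ x y, Asymptotic ρ T 1 x y → HolderWith B γ (hol T A x y) := by
  obtain ⟨B, hB0, hB⟩ := IsBunched.exists_holder_hol hθ hθα (by exact_mod_cast hα1) h zero_le_one
  have hle : γ ≤ (θ / 2).toNNReal := NNReal.le_toNNReal_of_coe_le hγ
  obtain ⟨B', hB'⟩ := exists_holderWith_of_le (G := G) hle B.toNNReal
  refine ⟨B', fun x y hxy => hB' _ (holderWith_of_dist_le hB0 fun p q => ?_)⟩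
  rw [Real.coe_toNNReal _ (by positivity)]
  exact hB x y hxy p q

/-- Existence of the holonomies of a cocycle whose expansion is `ρ ^ (α - θ)`, for every Hölder
exponent up to `θ / 2`. -/
lemma hasHolderHolonomies_of_isBunched {α γ : ℝ≥0} {θ C : ℝ} {f : Omega P → G ≃ₜ G}
    (hα1 : α ≤ 1) (hθ : 0 < θ) (hθα : θ ≤ α) (hγ : (γ : ℝ) ≤ θ / 2)
    (h : IsBunched ρ (α : ℝ) (shift P) f C 1 (ρ ^ ((α : ℝ) - θ))) :
    HasHolderHolonomies f γ := by
  refine ⟨⟨hol (shift P) f, ?_⟩, ⟨hol (shift P).symm (reversal f), ?_⟩⟩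
  · obtain ⟨B, hB⟩ := h.exists_holderWith_hol hα1 hθ hθα hγ
    refine isHolonomy_hol h (shift P).continuous
      (fun x y hy => exists_asymptotic_of_mem_Ws h.one_lt hy)
      (fun x y hy z hz => mem_Ws_of_mem_of_mem hy hz)
      (fun x y hy => asymptotic_one_of_mem_WsLoc h.one_lt hy) (fun x y u hu => ?_)
      (fun x y hy p => ?_) hB
    · simp_rw [tendsto_int_atTop_iff, iterInt_natCast]
      exact hu
    · obtain ⟨c, hc⟩ := exists_asymptotic_of_mem_Ws h.one_lt hy
      exact h.hol_equivariant (hc.nonneg h.one_lt) hc p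
  · obtain ⟨B, hB⟩ := h.reversal.exists_holderWith_hol hα1 hθ hθα hγ
    refine isHolonomy_hol h.reversal (shift P).symm.continuous
      (fun x y hy => exists_asymptotic_of_mem_Wu h.one_lt hy)
      (fun x y hy z hz => mem_Wu_of_mem_of_mem hy hz)
      (fun x y hy => asymptotic_one_of_mem_WuLoc h.one_lt hy) (fun x y u hu => ?_)
      (fun x y hy p => ?_) hB
    · simp_rw [tendsto_int_atBot_iff, iterInt_neg_natCast]
      exact hu
    · have hy' : shift P y ∈ Wu (shift P x) := by
        obtain ⟨m, hm⟩ := hy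
        exact ⟨m - 1, fun n hn => hm (n + 1) (by omega)⟩
      obtain ⟨c, hc⟩ := exists_asymptotic_of_mem_Wu h.one_lt hy'
      -- the equivariance of the reversed cocycle, from `(σ x, σ y)` to `(x, y)`
      have h1 := h.reversal.hol_equivariant (hc.nonneg h.one_lt) hc (f x p)
      simp only [LipCocycle.reversal, Homeomorph.symm_apply_apply] at h1
      have h2 : (f x)⁻¹ (f x p) = p := (f x).symm_apply_apply p
      rw [h2] at h1
      have h3 := congrArg (f y) h1
      exact h3.symm.trans ((f y).apply_symm_apply _)

end Existence

/-! ### A Lusin theorem for null-measurable maps -/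

section Lusin

lemma exists_isClosed_subset_measure_diff_le {X : Type*} [TopologicalSpace X] [MeasurableSpace X]
    [OpensMeasurableSpace X] {μ : Measure X} [IsFiniteMeasure μ] [μ.WeaklyRegular] {s : Set X}
    (hs : NullMeasurableSet s μ) {ε : ℝ≥0∞} (hε : ε ≠ 0) :
    ∃ F ⊆ s, IsClosed F ∧ μ (s \ F) ≤ ε := by
  obtain ⟨t, hts, ht, hae⟩ := hs.exists_measurable_subset_ae_eq
  obtain ⟨F, hFt, hF, hlt⟩ := ht.exists_isClosed_sdiff_lt (measure_ne_top μ t) hε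
  refine ⟨F, hFt.trans hts, hF, ?_⟩
  have h1 : (s \ F : Set X) =ᵐ[μ] (t \ F : Set X) := hae.symm.diff (ae_eq_refl F)
  rw [measure_congr h1]
  exact hlt.le

/-- **Lusin's theorem** for a null-measurable map into a second countable space. -/
lemma exists_isClosed_continuousOn {X Y : Type*} [TopologicalSpace X] [MeasurableSpace X]
    [OpensMeasurableSpace X] {μ : Measure X} [IsFiniteMeasure μ] [μ.WeaklyRegular]
    [TopologicalSpace Y] [SecondCountableTopology Y] {φ : X → Y}
    (hφ : ∀ U, IsOpen U → NullMeasurableSet (φ ⁻¹' U) μ) {ε : ℝ≥0∞} (hε : ε ≠ 0) :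
    ∃ K, IsClosed K ∧ μ Kᶜ ≤ ε ∧ ContinuousOn φ K := by
  let ι := TopologicalSpace.countableBasis Y
  obtain ⟨δ, hδ0, hδ⟩ := ENNReal.exists_pos_sum_of_countable' hε ι
  have hU : ∀ U : ι, NullMeasurableSet (φ ⁻¹' U.1) μ := fun U =>
    hφ _ (TopologicalSpace.isOpen_of_mem_countableBasis U.2)
  have hδ2 : ∀ U, δ U / 2 ≠ 0 := fun U => (ENNReal.half_pos (hδ0 U).ne').ne'
  -- closed approximations from inside, of the preimage of a basic open set and of its complement
  choose F hFs hF hFm using fun U : ι => exists_isClosed_subset_measure_diff_le (hU U) (hδ2 U)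
  choose F' hFs' hF' hFm' using
    fun U : ι => exists_isClosed_subset_measure_diff_le (hU U).compl (hδ2 U)
  refine ⟨⋂ U, F U ∪ F' U, isClosed_iInter fun U => (hF U).union (hF' U), ?_, ?_⟩
  · rw [Set.compl_iInter]
    refine (measure_iUnion_le _).trans ((ENNReal.tsum_le_tsum fun U => ?_).trans hδ.le)
    have hsub : (F U ∪ F' U)ᶜ ⊆ (φ ⁻¹' U.1 \ F U) ∪ ((φ ⁻¹' U.1)ᶜ \ F' U) := by
      intro x hx
      by_cases h : x ∈ φ ⁻¹' U.1
      · exact Or.inl ⟨h, fun h' => hx (Or.inl h')⟩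
      · exact Or.inr ⟨h, fun h' => hx (Or.inr h')⟩
    calc _ ≤ _ := (measure_mono hsub).trans (measure_union_le _ _)
      _ ≤ δ U / 2 + δ U / 2 := add_le_add (hFm U) (hFm' U)
      _ = δ U := ENNReal.add_halves _
  · intro x hx
    rw [ContinuousWithinAt,
      (TopologicalSpace.isBasis_countableBasis Y).nhds_hasBasis.tendsto_right_iff]
    rintro V ⟨hV, hxV⟩
    have hx' : x ∈ (F' ⟨V, hV⟩)ᶜ := fun h => hFs' ⟨V, hV⟩ h hxV
    filter_upwards [self_mem_nhdsWithin, mem_nhdsWithin_of_mem_nhds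
      ((hF' ⟨V, hV⟩).isOpen_compl.mem_nhds hx')] with y hy hy'
    rcases Set.mem_iInter.1 hy ⟨V, hV⟩ with h | h
    · exact hFs _ h
    · exact absurd h hy'

variable {k : ℕ} {P : Matrix (Fin k) (Fin k) ℕ}

instance compactSpace_omega : CompactSpace (Omega P) := by
  have hcl : IsClosed {x : ℤ → Fin k | ∀ n : ℤ, P (x n) (x (n + 1)) = 1} := by
    simp only [Set.ofPred_forall]
    refine isClosed_iInter fun n => ?_
    have hc : Continuous fun x : ℤ → Fin k => (x n, x (n + 1)) :=
      (continuous_apply n).prodMk (continuous_apply (n + 1))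
    exact (isClosed_discrete {q : Fin k × Fin k | P q.1 q.2 = 1}).preimage hc
  exact isCompact_iff_compactSpace.1 hcl.isCompact

instance pseudoMetrizableSpace_omega : TopologicalSpace.PseudoMetrizableSpace (Omega P) :=
  IsInducing.subtypeVal.pseudoMetrizableSpace

instance secondCountableTopology_omega : SecondCountableTopology (Omega P) :=
  IsInducing.subtypeVal.secondCountableTopology

/-- Uniform continuity on closed sets, in terms of agreement of coordinates. -/
lemma exists_agreeBelow_dist_lt {Y : Type*} [PseudoMetricSpace Y] {u : Omega P → Y}
    {K : Set (Omega P)} (hK : IsClosed K) (hu : ContinuousOn u K) {ε : ℝ} (hε : 0 < ε) :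
    ∃ N, ∀ z ∈ K, ∀ w ∈ K, AgreeBelow N z w → dist (u z) (u w) < ε := by
  have hd : ContinuousOn (fun q : Omega P × Omega P => dist (u q.1) (u q.2)) (K ×ˢ K) :=
    continuous_dist.comp_continuousOn ((hu.comp continuousOn_fst fun q hq => hq.1).prodMk
      (hu.comp continuousOn_snd fun q hq => hq.2))
  have hZ : IsClosed (K ×ˢ K ∩ (fun q : Omega P × Omega P => dist (u q.1) (u q.2)) ⁻¹' Set.Ici ε) :=
    hd.preimage_isClosed_of_isClosed (hK.prod hK) isClosed_Ici
  obtain ⟨N, hN⟩ := hZ.isCompact.elim_directed_family_closed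
    (fun N : ℕ => {q : Omega P × Omega P | AgreeBelow N q.1 q.2}) (fun N => isClosed_agreeBelow N)
    (by
      rw [Set.eq_empty_iff_forall_notMem]
      rintro ⟨z, w⟩ ⟨⟨-, hε'⟩, hzw⟩
      have : z = w := Subtype.ext (funext fun n =>
        Set.mem_iInter.1 hzw (n.natAbs + 1) n (by rw [Int.abs_eq_natAbs]; omega))
      subst this
      simp only [Set.mem_preimage, dist_self, Set.mem_Ici] at hε'
      linarith)
    (directed_of_isDirected_le fun N M h q hq => AgreeBelow.mono hq h)
  refine ⟨N, fun z hz w hw hzw => ?_⟩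
  by_contra! hc
  exact (Set.eq_empty_iff_forall_notMem.1 hN) (z, w) ⟨⟨⟨hz, hw⟩, hc⟩, hzw⟩

end Lusin

/-! ### Holonomy invariance of a measurable conjugacy -/

section Invariance

variable {k : ℕ} {P : Matrix (Fin k) (Fin k) ℕ} {G : Type*} [MetricSpace G]
  {ρ a C M Λ C' M' c : ℝ} {T : Omega P → Omega P} {A B φ : Omega P → G ≃ₜ G} {x y : Omega P}

lemma agreeBelow_of_dOmega_le (hρ : 1 < ρ) {N : ℕ} (h : dOmega ρ x y ≤ (ρ ^ N)⁻¹) :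
    AgreeBelow N x y := by
  by_cases hxy : x = y
  · exact fun n _ => by rw [hxy]
  · obtain ⟨M, hM, -, hd⟩ := exists_dOmega_eq hxy
    have hρ0 : 0 < ρ := by linarith
    rw [hd, inv_le_inv₀ (by positivity) (by positivity), pow_le_pow_iff_right₀ hρ] at h
    exact hM.mono h

lemma Asymptotic.eventually_agreeBelow (hρ : 1 < ρ) (h : Asymptotic ρ T c x y) (N : ℕ) :
    ∀ᶠ n in atTop, AgreeBelow N (T^[n] x) (T^[n] y) := by
  have h1 : Tendsto (fun n : ℕ => c / ρ ^ n) atTop (𝓝 0) :=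
    tendsto_const_nhds.div_atTop (tendsto_pow_atTop_atTop_of_one_lt hρ)
  have hρ0 : 0 < ρ := by linarith
  filter_upwards [h1.eventually_le_const (show 0 < (ρ ^ N)⁻¹ by positivity)] with n hn
  exact agreeBelow_of_dOmega_le hρ ((h n).trans hn)

lemma iter_mul_conjugacy (h : ∀ n, A (T^[n] x) = φ (T^[n + 1] x) * B (T^[n] x) * (φ (T^[n] x))⁻¹)
    (n : ℕ) : iter T A n x * φ x = φ (T^[n] x) * iter T B n x := by
  induction n with
  | zero => simp [iter]
  | succ n ih => rw [iter, mul_assoc, ih, h n, iter]; group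

variable [CompactSpace G]

/-- A conjugacy `φ` intertwines the holonomies from `x` to `y` if the orbits of `x` and `y` return
together, infinitely often, to a set `K` on which `φ` is uniformly continuous and `φ⁻¹` uniformly
`β`-Hölder. Indeed, with `x' = T^n x` and `y' = T^n y`,
`φ_y⁻¹ ∘ (A^n_y)⁻¹ ∘ A^n_x ∘ φ_x = (B^n_y)⁻¹ ∘ (φ_{y'}⁻¹ ∘ φ_{x'}) ∘ B^n_x`, where the middle factor is
close to the identity at the common return times and `(B^n_y)⁻¹` is uniformly Lipschitz. -/
lemma conjugacy_hol_of_frequently (hA : IsBunched ρ a T A C M Λ) (hB : IsBunched ρ a T B C' M' 1)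
    (hc : 0 ≤ c) (hxy : Asymptotic ρ T c x y)
    (hx : ∀ n, A (T^[n] x) = φ (T^[n + 1] x) * B (T^[n] x) * (φ (T^[n] x))⁻¹)
    (hy : ∀ n, A (T^[n] y) = φ (T^[n + 1] y) * B (T^[n] y) * (φ (T^[n] y))⁻¹)
    {K : Set (Omega P)} (hK : IsClosed K) (hφ : ContinuousOn (fun x => (φ x : C(G, G))) K)
    {L β : ℝ≥0} (hβ : 0 < β) (hL : ∀ z ∈ K, HolderWith L β (φ z).symm)
    (hfr : ∃ᶠ n in atTop, T^[n] x ∈ K ∧ T^[n] y ∈ K) (p : G) :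
    φ y (hol T B x y p) = hol T A x y (φ x p) := by
  have hlimB := hB.tendsto_hol_apply hc hxy p
  have hlimA := ((φ y).symm.continuous.tendsto _).comp (hA.tendsto_hol_apply hc hxy (φ x p))
  suffices h : (φ y).symm (hol T A x y (φ x p)) = hol T B x y p by
    rw [← h, Homeomorph.apply_symm_apply]
  have hM := hB.M_nonneg
  have hβ' : (0 : ℝ) < β := by exact_mod_cast hβ
  by_contra hne
  have hpos := dist_pos.2 hne
  have hsmall : Tendsto (fun ε : ℝ => M' * (L * ε ^ (β : ℝ))) (𝓝[>] 0) (𝓝 0) := by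
    have h1 : ContinuousAt (fun ε : ℝ => M' * (L * ε ^ (β : ℝ))) 0 :=
      continuousAt_const.mul (continuousAt_const.mul
        (Real.continuousAt_rpow_const _ _ (Or.inr hβ'.le)))
    have h2 := h1.tendsto
    simp only [Real.zero_rpow hβ'.ne', mul_zero] at h2
    exact h2.mono_left nhdsWithin_le_nhds
  obtain ⟨ε, hε1, hε0⟩ := ((hsmall.eventually_lt_const hpos).and self_mem_nhdsWithin).exists
  have hε0 : 0 < ε := hε0
  obtain ⟨N, hN⟩ := exists_agreeBelow_dist_lt hK hφ hε0
  have hev := (hlimA.dist hlimB).eventually_const_lt hε1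
  obtain ⟨n, ⟨hnx, hny⟩, hn, hag⟩ :=
    (hfr.and_eventually (hev.and (hxy.eventually_agreeBelow hA.one_lt N))).exists
  refine hn.not_ge ?_
  set q := iter T B n x p
  have e1 : iter T A n x (φ x p) = φ (T^[n] x) q :=
    DFunLike.congr_fun (iter_mul_conjugacy hx n) p
  have e2 : ∀ r, (φ y).symm ((iter T A n y).symm r) =
      (iter T B n y).symm ((φ (T^[n] y)).symm r) := fun r =>
    DFunLike.congr_fun (congrArg (·⁻¹) (iter_mul_conjugacy hy n)) r
  have h1 : dist (φ (T^[n] x) q) (φ (T^[n] y) q) ≤ ε :=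
    (ContinuousMap.dist_apply_le_dist (f := (φ (T^[n] x) : C(G, G)))
      (g := (φ (T^[n] y) : C(G, G))) q).trans (hN _ hnx _ hny hag).le
  have h2 := (hL _ hny).dist_le_of_le h1
  rw [Homeomorph.symm_apply_apply] at h2
  simp only [Function.comp_apply]
  rw [e1, e2]
  have h3 := hB.iter_symm_le n y ((φ (T^[n] y)).symm (φ (T^[n] x) q)) q
  rw [one_pow, mul_one] at h3
  exact h3.trans (mul_le_mul_of_nonneg_left h2 hM)

/-- Sets of almost full measure on which the conjugacy is continuous and its values have uniformly
Hölder inverses. -/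
lemma exists_isClosed_continuousOn_holderWith_symm {μ : Measure (Omega P)} [IsFiniteMeasure μ]
    {β : ℝ≥0} (hφ : ∀ x, MemHolder β (φ x).symm)
    (hm : ∀ U : Set C(G, G), IsOpen U → NullMeasurableSet {x | (φ x : C(G, G)) ∈ U} μ)
    {δ : ℝ≥0∞} (hδ : δ ≠ 0) :
    ∃ (K : Set (Omega P)) (L : ℝ≥0), IsClosed K ∧ μ Kᶜ ≤ δ ∧
      ContinuousOn (fun x => (φ x : C(G, G))) K ∧ ∀ z ∈ K, HolderWith L β (φ z).symm := by
  have hδ3 : δ / 3 ≠ 0 := (ENNReal.div_pos hδ (by norm_num)).ne'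
  let S : ℕ → Set (Omega P) := fun n => {x | HolderWith n β (φ x).symm}
  have hS : ∀ n, NullMeasurableSet (S n) μ := by
    intro n
    have hcl : IsClosed {e : C(G, G) | ∀ p q, dist p q ≤ n * dist (e p) (e q) ^ (β : ℝ)} := by
      simp only [Set.ofPred_forall]
      refine isClosed_iInter fun p => isClosed_iInter fun q =>
        isClosed_le continuous_const (continuous_const.mul (Continuous.rpow_const ?_ ?_))
      · exact (continuous_eval_const p).dist (continuous_eval_const q)
      · exact fun _ => Or.inr β.coe_nonneg
    have hSn : S n = {x | (φ x : C(G, G)) ∈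
        {e : C(G, G) | ∀ p q, dist p q ≤ n * dist (e p) (e q) ^ (β : ℝ)}ᶜ}ᶜ := by
      ext x
      constructor
      · intro h hx
        refine hx fun p q => ?_
        simpa using HolderWith.dist_le h (φ x p) (φ x q)
      · intro h
        have h' := not_not.1 h
        have := holderWith_of_dist_le (u := (φ x).symm) (B := n) (r := β) (Nat.cast_nonneg n)
          fun p q => by simpa using h' ((φ x).symm p) ((φ x).symm q)
        simpa [S] using this
    rw [hSn]
    exact (hm _ hcl.isOpen_compl).compl
  have hSmono : Monotone S := fun n m h x hx =>
    HolderWith.mono hx (by exact_mod_cast h)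
  have hSU : ⋂ n, (S n)ᶜ = ∅ := by
    rw [Set.eq_empty_iff_forall_notMem]
    intro x hx
    obtain ⟨D, hD⟩ := hφ x
    obtain ⟨n, hn⟩ := exists_nat_ge D
    exact Set.mem_iInter.1 hx n (hD.mono hn)
  have hlim : Tendsto (fun n => μ (S n)ᶜ) atTop (𝓝 0) := by
    have := tendsto_measure_iInter_atTop (μ := μ) (s := fun n => (S n)ᶜ) (fun n => (hS n).compl)
      (fun n m h => Set.compl_subset_compl.2 (hSmono h)) ⟨0, measure_ne_top _ _⟩
    rwa [hSU, measure_empty] at this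
  obtain ⟨n, hn⟩ := (hlim.eventually_le_const (pos_iff_ne_zero.2 hδ3)).exists
  obtain ⟨F, hFS, hF, hFm⟩ := exists_isClosed_subset_measure_diff_le (hS n) hδ3
  obtain ⟨K, hK, hKm, hKc⟩ := exists_isClosed_continuousOn (φ := fun x => (φ x : C(G, G))) hm hδ3
  refine ⟨K ∩ F, n, hK.inter hF, ?_, hKc.mono Set.inter_subset_left, fun z hz => hFS hz.2⟩
  have hsub : (K ∩ F)ᶜ ⊆ Kᶜ ∪ ((S n \ F) ∪ (S n)ᶜ) := by
    intro x hx
    by_cases h1 : x ∈ K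
    · by_cases h2 : x ∈ S n
      · exact Or.inr (Or.inl ⟨h2, fun h3 => hx ⟨h1, h3⟩⟩)
      · exact Or.inr (Or.inr h2)
    · exact Or.inl h1
  calc _ ≤ _ := (measure_mono hsub).trans
        ((measure_union_le _ _).trans (add_le_add_right (measure_union_le _ _) _))
    _ ≤ δ / 3 + (δ / 3 + δ / 3) := add_le_add hKm (add_le_add hFm hn)
    _ = δ := by rw [← add_assoc, ENNReal.add_thirds]

/-- Let `θ ↦ (X θ, Y θ)` be a measured family of pairs of asymptotic points, both of whose marginals
are dominated by the invariant measure `μ`. Then a measurable conjugacy intertwines the holonomies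
of almost every pair: the times at which one of the points is outside a set `K` have small measure,
uniformly in time, hence so has the set of pairs for which this happens at all large times. -/
lemma ae_conjugacy_hol {μ : Measure (Omega P)} [IsFiniteMeasure μ] {Θ : Type*} [MeasurableSpace Θ]
    {m : Measure Θ} {X Y : Θ → Omega P} {S : Set Θ} {D : ℝ≥0∞} (hD : D ≠ ∞)
    (hX : ∀ E, m (S ∩ X ⁻¹' E) ≤ D * μ E) (hY : ∀ E, m (S ∩ Y ⁻¹' E) ≤ D * μ E)
    (hT : MeasurePreserving T μ μ)
    (hA : IsBunched ρ a T A C M Λ) (hB : IsBunched ρ a T B C' M' 1)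
    (hXY : ∀ θ ∈ S, Asymptotic ρ T 1 (X θ) (Y θ))
    {β : ℝ≥0} (hβ : 0 < β) (hφ : ∀ x, MemHolder β (φ x).symm)
    (hm : ∀ U : Set C(G, G), IsOpen U → NullMeasurableSet {x | (φ x : C(G, G)) ∈ U} μ)
    (hconj : ∀ᵐ x ∂μ, A x = φ (T x) * B x * (φ x)⁻¹) :
    ∀ᵐ θ ∂m, θ ∈ S → ∀ p,
      φ (Y θ) (hol T B (X θ) (Y θ) p) = hol T A (X θ) (Y θ) (φ (X θ) p) := by
  have hconj' : ∀ᵐ x ∂μ, ∀ n,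
      A (T^[n] x) = φ (T^[n + 1] x) * B (T^[n] x) * (φ (T^[n] x))⁻¹ := by
    rw [ae_all_iff]
    intro n
    filter_upwards [(hT.iterate n).quasiMeasurePreserving.ae hconj] with x hx
    rwa [Function.iterate_succ_apply']
  set N₀ := {x | ¬ ∀ n, A (T^[n] x) = φ (T^[n + 1] x) * B (T^[n] x) * (φ (T^[n] x))⁻¹} with hN₀
  have hN₀μ : μ N₀ = 0 := hconj'
  choose K L hKcl hKm hKc hKL using fun j : ℕ =>
    exists_isClosed_continuousOn_holderWith_symm (μ := μ) hφ hm
      (δ := ((j : ℝ≥0∞) + 1)⁻¹) (by simp)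
  let Z : ℕ → ℕ → Set Θ := fun j N =>
    {θ | θ ∈ S ∧ ∀ n, N ≤ n → ¬ (T^[n] (X θ) ∈ K j ∧ T^[n] (Y θ) ∈ K j)}
  have hZ : ∀ j, m (⋃ N, Z j N) ≤ 2 * D * ((j : ℝ≥0∞) + 1)⁻¹ := by
    intro j
    have hmono : Monotone (Z j) := fun N N' h θ hθ => ⟨hθ.1, fun n hn => hθ.2 n (h.trans hn)⟩
    rw [hmono.measure_iUnion]
    refine iSup_le fun N => ?_
    have hsub : Z j N ⊆ (S ∩ X ⁻¹' (T^[N] ⁻¹' (K j)ᶜ)) ∪ (S ∩ Y ⁻¹' (T^[N] ⁻¹' (K j)ᶜ)) := by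
      rintro θ ⟨hθ, h⟩
      by_cases h1 : T^[N] (X θ) ∈ K j
      · exact Or.inr ⟨hθ, fun h2 => h N le_rfl ⟨h1, h2⟩⟩
      · exact Or.inl ⟨hθ, h1⟩
    have hpre : μ (T^[N] ⁻¹' (K j)ᶜ) ≤ ((j : ℝ≥0∞) + 1)⁻¹ := by
      rw [(hT.iterate N).measure_preimage (hKcl j).measurableSet.compl.nullMeasurableSet]
      exact hKm j
    calc _ ≤ _ := (measure_mono hsub).trans (measure_union_le _ _)
      _ ≤ D * ((j : ℝ≥0∞) + 1)⁻¹ + D * ((j : ℝ≥0∞) + 1)⁻¹ :=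
        add_le_add ((hX _).trans (mul_le_mul_right hpre _)) ((hY _).trans (mul_le_mul_right hpre _))
      _ = _ := by ring
  have hZ0 : m (⋂ j, ⋃ N, Z j N) = 0 := by
    have hlim : Tendsto (fun j : ℕ => 2 * D * ((j : ℝ≥0∞) + 1)⁻¹) atTop (𝓝 0) := by
      have h1 := (ENNReal.tendsto_inv_nat_nhds_zero.comp (tendsto_add_atTop_nat 1))
      have h2 := ENNReal.Tendsto.const_mul (a := 2 * D) h1
        (Or.inr (ENNReal.mul_ne_top (by norm_num) hD))
      simpa using h2
    exact le_antisymm (ge_of_tendsto' hlim fun j =>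
      (measure_mono (Set.iInter_subset _ j)).trans (hZ j)) bot_le
  have hX0 : m (S ∩ X ⁻¹' N₀) = 0 := le_antisymm ((hX N₀).trans (by simp [hN₀μ])) bot_le
  have hY0 : m (S ∩ Y ⁻¹' N₀) = 0 := le_antisymm ((hY N₀).trans (by simp [hN₀μ])) bot_le
  filter_upwards [measure_eq_zero_iff_ae_notMem.1 hX0, measure_eq_zero_iff_ae_notMem.1 hY0,
    measure_eq_zero_iff_ae_notMem.1 hZ0] with θ h1 h2 h3 hθ p
  have hx := not_not.1 fun h => h1 ⟨hθ, h⟩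
  have hy := not_not.1 fun h => h2 ⟨hθ, h⟩
  rw [Set.mem_iInter, not_forall] at h3
  obtain ⟨j, hj⟩ := h3
  refine conjugacy_hol_of_frequently hA hB zero_le_one (hXY θ hθ) hx hy (hKcl j) (hKc j) hβ (hKL j)
    ?_ p
  rw [frequently_atTop]
  intro N
  by_contra! hc
  exact hj (Set.mem_iUnion.2 ⟨N, hθ, fun n hn h => hc n hn h.1 h.2⟩)

end Invariance

/-! ### Brackets and the local product structure -/

section Bracket

variable {k : ℕ} {P : Matrix (Fin k) (Fin k) ℕ} {x y : Omega P} {N : ℕ}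

open Classical in
/-- The point with the past of `x` and the future of `y`, if these share the zeroth symbol, and
`y` otherwise. -/
noncomputable def bracket (x y : Omega P) : Omega P :=
  if h : x.1 0 = y.1 0 then glue (projU x) (projS y) (by simpa [projU, projS] using h) else y

lemma bracket_apply (h : x.1 0 = y.1 0) (n : ℤ) :
    (bracket x y).1 n = if 0 ≤ n then y.1 n else x.1 n := by
  simp only [bracket, h, dif_pos, glue, projU, projS]
  split_ifs with hn
  · rw [Int.toNat_of_nonneg hn]
  · rw [Int.toNat_of_nonneg (by omega), neg_neg]

lemma bracket_mem_WuLoc (h : x.1 0 = y.1 0) : bracket x y ∈ WuLoc x := by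
  intro n hn
  rw [bracket_apply h]
  split_ifs with h0
  · rwa [le_antisymm hn h0]
  · rfl

lemma mem_WsLoc_bracket (h : x.1 0 = y.1 0) : y ∈ WsLoc (bracket x y) := by
  intro n hn
  rw [bracket_apply h, if_pos hn]

lemma AgreeBelow.bracket_right (h : x.1 0 = y.1 0) (hN : AgreeBelow N x y) :
    AgreeBelow N x (bracket x y) := by
  intro n hn
  rw [bracket_apply h]
  split_ifs
  · exact hN n hn
  · rfl

lemma AgreeBelow.bracket_left (h : x.1 0 = y.1 0) (hN : AgreeBelow N x y) :
    AgreeBelow N (bracket x y) y := (hN.bracket_right h).symm.trans hN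

lemma measurable_of_measurable_val_apply {X ι : Type*} [MeasurableSpace X]
    {p : (ι → Fin k) → Prop} {f : X → {x // p x}} (h : ∀ n, Measurable fun a => (f a).1 n) :
    Measurable f :=
  Measurable.subtype_mk (f := fun a => (f a).1) (measurable_pi_lambda _ h)

lemma measurable_val_apply {ι : Type*} {p : (ι → Fin k) → Prop} (n : ι) :
    Measurable fun x : {x // p x} => x.1 n :=
  (measurable_pi_apply n).comp measurable_subtype_coe

lemma measurable_projU : Measurable (projU : Omega P → OmegaMinus P) :=
  measurable_of_measurable_val_apply fun n => measurable_val_apply (-(n : ℤ))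

lemma measurable_projS : Measurable (projS : Omega P → OmegaPlus P) :=
  measurable_of_measurable_val_apply fun n => measurable_val_apply (n : ℤ)

open Classical in
/-- Gluing a past and a future, extended by the constant `x₀` to incompatible pairs. -/
noncomputable def glueExtend (x₀ : Omega P) (q : OmegaMinus P × OmegaPlus P) : Omega P :=
  if h : q.1.1 0 = q.2.1 0 then glue q.1 q.2 h else x₀

lemma measurable_glueExtend (x₀ : Omega P) : Measurable (glueExtend x₀) := by
  classical
  have hm : ∀ n, Measurable fun q : OmegaMinus P × OmegaPlus P => q.1.1 n := fun n =>
    (measurable_val_apply n).comp measurable_fst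
  have hp : ∀ n, Measurable fun q : OmegaMinus P × OmegaPlus P => q.2.1 n := fun n =>
    (measurable_val_apply n).comp measurable_snd
  refine measurable_of_measurable_val_apply fun n => ?_
  have heq : (fun q => (glueExtend x₀ q).1 n) = fun q : OmegaMinus P × OmegaPlus P =>
      if q.1.1 0 = q.2.1 0 then (if 0 ≤ n then q.2.1 n.toNat else q.1.1 (-n).toNat)
      else x₀.1 n := by
    funext q
    by_cases h : q.1.1 0 = q.2.1 0 <;> simp [glueExtend, h, glue]
  rw [heq]
  refine Measurable.ite (measurableSet_eq_fun (hm 0) (hp 0)) ?_ measurable_const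
  by_cases h : 0 ≤ n
  · simpa only [h, if_true] using hp _
  · simpa only [h, if_false] using hm _

/-- Under the local product structure, the law of the bracket of two independent points is
dominated by `μ`: the past and the future of the bracket are independent with laws `μ^u` and `μ^s`,
and the density `D` is bounded below. -/
lemma HasLocalProductStructure.exists_measure_bracket_le {μ : Measure (Omega P)}
    [IsProbabilityMeasure μ] (hμ : HasLocalProductStructure μ) :
    ∃ c : ℝ≥0∞, c ≠ ∞ ∧ ∀ E : Set (Omega P),
      (μ.prod μ) ({q | q.1.1 0 = q.2.1 0} ∩ (fun q => bracket q.1 q.2) ⁻¹' E) ≤ c * μ E := by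
  classical
  obtain ⟨D, hDc, hDpos, hD⟩ := hμ
  have : Nonempty (Omega P) := nonempty_of_isProbabilityMeasure μ
  obtain ⟨x₀, -, hx₀⟩ := isCompact_univ.exists_isMinOn Set.univ_nonempty hDc.continuousOn
  have hδ : ENNReal.ofReal (D x₀) ≠ 0 := by simpa using hDpos x₀
  have hmeas : ∀ E, MeasurableSet E →
      (μ.prod μ) ({q | q.1.1 0 = q.2.1 0} ∩ (fun q => bracket q.1 q.2) ⁻¹' E) ≤
        (k * (ENNReal.ofReal (D x₀))⁻¹) * μ E := by
    intro E hE
    have hsym : ∀ i : Fin k, MeasurableSet {x : Omega P | x.1 0 = i} := fun i =>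
      measurable_val_apply (0 : ℤ) (measurableSet_singleton i)
    let R : Fin k → Set (OmegaMinus P × OmegaPlus P) := fun i =>
      {q | q.1.1 0 = i} ∩ {q | q.2.1 0 = i} ∩ glueExtend x₀ ⁻¹' E
    have hR : ∀ i, MeasurableSet (R i) := by
      intro i
      refine (MeasurableSet.inter ?_ ?_).inter (measurable_glueExtend x₀ hE)
      · exact ((measurable_val_apply 0).comp measurable_fst)
          (measurableSet_singleton i)
      · exact ((measurable_val_apply 0).comp measurable_snd)
          (measurableSet_singleton i)
    have hRμ : ∀ i, ((μ.map projU).prod (μ.map projS)) (R i) ≤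
        (ENNReal.ofReal (D x₀))⁻¹ * μ E := by
      intro i
      rw [mul_comm, ← div_eq_mul_inv, ENNReal.le_div_iff_mul_le (Or.inl hδ)
        (Or.inl ENNReal.ofReal_ne_top)]
      refine le_trans ?_ (measure_mono (Set.inter_subset_left (s := E) (t := {x | x.1 0 = i})))
      rw [hD i _ (hE.inter (hsym i)) Set.inter_subset_right, mul_comm,
        ← lintegral_indicator_const (hR i)]
      refine lintegral_mono fun q => ?_
      by_cases hq : q ∈ R i
      · have hq' : q.1.1 0 = i ∧ q.2.1 0 = i := hq.1
        have hg : glueExtend x₀ q = glue q.1 q.2 (hq'.1.trans hq'.2.symm) := by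
          rw [glueExtend, dif_pos]
        have hE' : glue q.1 q.2 (hq'.1.trans hq'.2.symm) ∈ E ∩ {x | x.1 0 = i} := by
          refine ⟨hg ▸ hq.2, ?_⟩
          simpa [glue] using hq'.2
        rw [Set.indicator_of_mem hq, dif_pos hq', Set.indicator_of_mem hE']
        exact ENNReal.ofReal_le_ofReal (hx₀ (Set.mem_univ _))
      · rw [Set.indicator_of_notMem hq]
        exact bot_le
    have hsub : {q : Omega P × Omega P | q.1.1 0 = q.2.1 0} ∩
        (fun q => bracket q.1 q.2) ⁻¹' E ⊆ ⋃ i, Prod.map projU projS ⁻¹' R i := by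
      rintro ⟨x, y⟩ ⟨hxy, hE⟩
      have hxy : x.1 0 = y.1 0 := hxy
      refine Set.mem_iUnion.2 ⟨x.1 0, ⟨by simp [projU], by simp [projS, hxy]⟩, ?_⟩
      have hc : (projU x).1 0 = (projS y).1 0 := by simpa [projU, projS] using hxy
      have : glueExtend x₀ (projU x, projS y) = bracket x y := by
        rw [glueExtend, dif_pos hc, bracket, dif_pos hxy]
      change glueExtend x₀ (projU x, projS y) ∈ E
      rw [this]
      exact hE
    calc _ ≤ _ := (measure_mono hsub).trans (measure_iUnion_le _)
      _ ≤ ∑' _ : Fin k, (ENNReal.ofReal (D x₀))⁻¹ * μ E := by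
        refine ENNReal.tsum_le_tsum fun i => ?_
        rw [← Measure.map_apply (measurable_projU.prodMap measurable_projS) (hR i),
          ← Measure.map_prod_map _ _ measurable_projU measurable_projS]
        exact hRμ i
      _ = _ := by simp [mul_assoc]
  refine ⟨k * (ENNReal.ofReal (D x₀))⁻¹,
    ENNReal.mul_ne_top (ENNReal.natCast_ne_top k) (ENNReal.inv_ne_top.2 hδ), fun E => ?_⟩
  rw [← measure_toMeasurable E]
  exact (measure_mono (Set.inter_subset_inter_right _ (Set.preimage_mono
    (subset_toMeasurable μ E)))).trans (hmeas _ (measurableSet_toMeasurable μ E))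

lemma measure_inter_preimage_fst_le (μ : Measure (Omega P)) [IsProbabilityMeasure μ]
    (S : Set (Omega P × Omega P)) (E : Set (Omega P)) :
    (μ.prod μ) (S ∩ Prod.fst ⁻¹' E) ≤ 1 * μ E := by
  rw [one_mul, ← measure_toMeasurable E, ← (measurePreserving_fst (μ := μ) (ν := μ)).measure_preimage
    (measurableSet_toMeasurable μ E).nullMeasurableSet]
  exact measure_mono fun q hq => subset_toMeasurable μ E hq.2

lemma measure_inter_preimage_snd_le (μ : Measure (Omega P)) [IsProbabilityMeasure μ]
    (S : Set (Omega P × Omega P)) (E : Set (Omega P)) :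
    (μ.prod μ) (S ∩ Prod.snd ⁻¹' E) ≤ 1 * μ E := by
  rw [one_mul, ← measure_toMeasurable E, ← (measurePreserving_snd (μ := μ) (ν := μ)).measure_preimage
    (measurableSet_toMeasurable μ E).nullMeasurableSet]
  exact measure_mono fun q hq => subset_toMeasurable μ E hq.2

end Bracket

/-! ### The Hölder conjugacy -/

section Conjugacy

variable {k : ℕ} {P : Matrix (Fin k) (Fin k) ℕ} {G : Type*} [MetricSpace G] [CompactSpace G]
  {ρ a C M Λ C' M' c : ℝ} {T : Omega P → Omega P} {A B : Omega P → G ≃ₜ G} {x y z : Omega P}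

/-- The holonomy between asymptotic points as a homeomorphism, with inverse the holonomy in the
opposite direction. -/
noncomputable def holHomeo (h : IsBunched ρ a T A C M Λ) (hxy : Asymptotic ρ T 1 x y) :
    G ≃ₜ G where
  toFun := hol T A x y
  invFun := hol T A y x
  left_inv := h.hol_hol_symm zero_le_one hxy
  right_inv := h.hol_hol_symm zero_le_one hxy.symm
  continuous_toFun := (hol T A x y).continuous
  continuous_invFun := (hol T A y x).continuous

lemma IsBunched.continuous_hol_comp (h : IsBunched ρ a T A C M Λ) (hT : Continuous T)
    {X : Type*} [TopologicalSpace X] {u v : X → Omega P} {r : X → G} (hu : Continuous u)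
    (hv : Continuous v) (hr : Continuous r) (huv : ∀ t, Asymptotic ρ T 1 (u t) (v t)) :
    Continuous fun t => hol T A (u t) (v t) (r t) := by
  let S : Set (Omega P × Omega P × G) := Set.range fun t => (u t, v t, r t)
  have hS : ∀ q ∈ S, Asymptotic ρ T 1 q.1 q.2.1 := by
    rintro q ⟨t, ht⟩
    rw [← ht]
    exact huv t
  have h1 := h.continuousOn_hol hT zero_le_one hS
  have h2 : Continuous fun t => (u t, v t, r t) := hu.prodMk (hv.prodMk hr)
  have h3 := h1.comp_continuous h2 (fun t => Set.mem_range_self t)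
  exact h3

/-- If `e_z ∘ h^B_{xz} = h^A_{xz} ∘ e_x`, then `e_z` is close to `e_x`, as the holonomies are
close to the identity; the holonomy of `B` is absorbed by the Hölder continuity of `e_x`. -/
lemma exists_dist_le_of_conj_hol (hA : IsBunched ρ a T A C M Λ) (hB : IsBunched ρ a T B C' M' 1)
    {D e : ℝ≥0} (he1 : e ≤ 1) :
    ∃ K : ℝ, 0 ≤ K ∧ ∀ (x z : Omega P) (e₁ e₂ : G → G) (r : ℝ),
      Asymptotic ρ T (dOmega ρ x z) x z → HolderWith D e e₁ →
      (∀ p, e₂ (hol T B x z p) = hol T A x z (e₁ p)) → dOmega ρ x z ≤ r → r ≤ 1 →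
      ∀ p, dist (e₂ p) (e₁ p) ≤ K * r ^ (a * e) := by
  set K₁ := M * Λ * C / (1 - Λ / ρ ^ a)
  set K₂ := M' * 1 * C' / (1 - 1 / ρ ^ a)
  have hK₁ : 0 ≤ K₁ := div_nonneg (mul_nonneg (mul_nonneg hA.M_nonneg hA.rate_pos.le) hA.C_nonneg)
    (sub_nonneg.2 hA.ratio_lt_one.le)
  have hK₂ : 0 ≤ K₂ := div_nonneg (mul_nonneg (mul_nonneg hB.M_nonneg zero_le_one) hB.C_nonneg)
    (sub_nonneg.2 hB.ratio_lt_one.le)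
  have ha := hA.exponent_pos
  refine ⟨K₁ + D * K₂ ^ (e : ℝ), by positivity, fun x z e₁ e₂ r hxz he₁ hconj hr hr1 p => ?_⟩
  have hd0 := dOmega_nonneg hA.one_lt x z
  have hr0 : 0 ≤ r := hd0.trans hr
  have hda : dOmega ρ x z ^ a ≤ r ^ a := Real.rpow_le_rpow hd0 hr ha.le
  set q := hol T B z x p
  have hq : hol T B x z q = p := hB.hol_hol_symm hd0 hxz.symm p
  have h1 : dist (hol T A x z (e₁ q)) (e₁ q) ≤ K₁ * r ^ a :=
    (hA.dist_hol_le hd0 hxz _).trans (mul_le_mul_of_nonneg_left hda hK₁)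
  have h2 : dist q p ≤ K₂ * r ^ a :=
    (hB.dist_hol_le hd0 hxz.symm _).trans (mul_le_mul_of_nonneg_left hda hK₂)
  have h3 := he₁.dist_le_of_le h2
  rw [Real.mul_rpow hK₂ (by positivity), ← Real.rpow_mul hr0] at h3
  have h4 : r ^ a ≤ r ^ (a * e) := by
    rcases hr0.eq_or_lt with h0 | h0
    · rw [← h0, Real.zero_rpow ha.ne']
      positivity
    · exact Real.rpow_le_rpow_of_exponent_ge h0 hr1
        (mul_le_of_le_one_right ha.le (by exact_mod_cast he1))
  rw [← hq, hconj q, hq]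
  calc _ ≤ _ := dist_triangle _ (e₁ q) _
    _ ≤ K₁ * r ^ (a * e) + D * (K₂ ^ (e : ℝ) * r ^ (a * e)) :=
      add_le_add (h1.trans (mul_le_mul_of_nonneg_left h4 hK₁)) h3
    _ = _ := by ring

end Conjugacy

section Main

variable {k : ℕ} {P : Matrix (Fin k) (Fin k) ℕ} {G : Type*} [MetricSpace G]
  {ρ a C M Λ C' M' : ℝ} {f g φ : Omega P → G ≃ₜ G}

/-- The conjugacy `φ` intertwines the unstable holonomies from `x` to the bracket `[x, y]` and the
stable holonomies from `[x, y]` to `y`. -/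
def IntertwinesHol (f g φ : Omega P → G ≃ₜ G) (x y : Omega P) : Prop :=
  (∀ p, φ (bracket x y) (hol (shift P).symm (reversal g) x (bracket x y) p) =
    hol (shift P).symm (reversal f) x (bracket x y) (φ x p)) ∧
  ∀ p, φ y (hol (shift P) g (bracket x y) y p) = hol (shift P) f (bracket x y) y
    (φ (bracket x y) p)

/-- Base points, one for each symbol, from which `φ` is determined almost everywhere on the
cylinder by holonomy invariance. -/
lemma exists_basePoints {μ : Measure (Omega P)} [IsProbabilityMeasure μ] [μ.IsOpenPosMeasure]
    (h : ∀ᵐ q ∂μ.prod μ, q.1.1 0 = q.2.1 0 → IntertwinesHol f g φ q.1 q.2) :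
    ∃ W : Fin k → Omega P, (∀ x : Omega P, (W (x.1 0)).1 0 = x.1 0) ∧
      ∀ᵐ y ∂μ, IntertwinesHol f g φ (W (y.1 0)) y := by
  have : Nonempty (Omega P) := nonempty_of_isProbabilityMeasure μ
  have h1 : ∀ i : Fin k, ∃ w : Omega P, ∀ x : Omega P, x.1 0 = i → w.1 0 = i ∧
      ∀ᵐ y ∂μ, w.1 0 = y.1 0 → IntertwinesHol f g φ w y := by
    intro i
    by_cases hi : ∃ x : Omega P, x.1 0 = i
    · have hopen : IsOpen {x : Omega P | x.1 0 = i} :=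
        (isOpen_discrete {i}).preimage (continuous_val_apply 0)
      obtain ⟨w, hw, hwi⟩ := (Measure.dense_of_ae (Measure.ae_ae_of_ae_prod h)).inter_open_nonempty
        _ hopen hi
      exact ⟨w, fun x _ => ⟨hw, hwi⟩⟩
    · exact ⟨Classical.arbitrary _, fun x hx => absurd ⟨x, hx⟩ hi⟩
  choose W hW using h1
  refine ⟨W, fun x => (hW _ x rfl).1, ?_⟩
  have h2 : ∀ᵐ y ∂μ, ∀ i, ∀ x : Omega P, x.1 0 = i → (W i).1 0 = y.1 0 →
      IntertwinesHol f g φ (W i) y := by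
    rw [ae_all_iff]
    intro i
    by_cases hi : ∃ x : Omega P, x.1 0 = i
    · obtain ⟨x, hx⟩ := hi
      filter_upwards [(hW i x hx).2] with y hy _ _
      exact hy
    · exact Eventually.of_forall fun y x hx => absurd ⟨x, hx⟩ hi
  filter_upwards [h2] with y hy
  exact hy _ y rfl (hW _ y rfl).1

lemma continuous_bracket_of_basePoints {W : Fin k → Omega P}
    (hW : ∀ x : Omega P, (W (x.1 0)).1 0 = x.1 0) :
    Continuous fun x : Omega P => bracket (W (x.1 0)) x := by
  refine Continuous.subtype_mk (f := fun x : Omega P => (bracket (W (x.1 0)) x).1)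
    (continuous_pi fun n => ?_) _
  have heq : (fun x : Omega P => (bracket (W (x.1 0)) x).1 n) =
      fun x => if 0 ≤ n then x.1 n else (W (x.1 0)).1 n := by
    funext x
    rw [bracket_apply (hW x)]
  rw [heq]
  by_cases hn : 0 ≤ n
  · simpa only [hn, if_true] using continuous_val_apply n
  · simp only [hn, if_false]
    exact (continuous_of_discreteTopology (f := fun i => (W i).1 n)).comp (continuous_val_apply 0)

variable [CompactSpace G]

lemma ae_intertwinesHol {μ : Measure (Omega P)} [IsProbabilityMeasure μ]
    (hσ : MeasurePreserving (shift P) μ μ) (hμ : HasLocalProductStructure μ)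
    (hf : IsBunched ρ a (shift P) f C M Λ) (hg : IsBunched ρ a (shift P) g C' M' 1)
    {β : ℝ≥0} (hβ : 0 < β) (hφ : ∀ x, MemHolder β (φ x).symm)
    (hm : ∀ U : Set C(G, G), IsOpen U → NullMeasurableSet {x | (φ x : C(G, G)) ∈ U} μ)
    (hconj : ∀ᵐ x ∂μ, f x = φ (shift P x) * g x * (φ x)⁻¹) :
    ∀ᵐ q ∂μ.prod μ, q.1.1 0 = q.2.1 0 → IntertwinesHol f g φ q.1 q.2 := by
  have hρ := hf.one_lt
  obtain ⟨c, hc, hbr⟩ := hμ.exists_measure_bracket_le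
  have hσ' : MeasurePreserving (shift P).symm μ μ :=
    MeasurePreserving.symm (shift P).toMeasurableEquiv hσ
  have hconj' : ∀ᵐ x ∂μ,
      reversal f x = φ ((shift P).symm x) * reversal g x * (φ x)⁻¹ := by
    filter_upwards [hσ'.quasiMeasurePreserving.ae hconj] with x hx
    rw [Homeomorph.apply_symm_apply] at hx
    rw [reversal, hx, reversal]
    group
  have hle : ∀ {E : Set (Omega P)}, 1 * μ E ≤ (c + 1) * μ E := mul_le_mul_left le_add_self _
  have hle' : ∀ {E : Set (Omega P)}, c * μ E ≤ (c + 1) * μ E := mul_le_mul_left le_self_add _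
  have hc1 : c + 1 ≠ ∞ := ENNReal.add_ne_top.2 ⟨hc, ENNReal.one_ne_top⟩
  have hU := ae_conjugacy_hol (m := μ.prod μ) (X := Prod.fst) (Y := fun q => bracket q.1 q.2)
    (S := {q | q.1.1 0 = q.2.1 0}) hc1 (fun E => (measure_inter_preimage_fst_le μ _ E).trans hle)
    (fun E => (hbr E).trans hle') hσ' hf.reversal hg.reversal
    (fun q hq => asymptotic_one_of_mem_WuLoc hρ (bracket_mem_WuLoc hq)) hβ hφ hm hconj'
  have hS := ae_conjugacy_hol (m := μ.prod μ) (X := fun q => bracket q.1 q.2) (Y := Prod.snd)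
    (S := {q | q.1.1 0 = q.2.1 0}) hc1 (fun E => (hbr E).trans hle')
    (fun E => (measure_inter_preimage_snd_le μ _ E).trans hle) hσ hf hg
    (fun q hq => asymptotic_one_of_mem_WsLoc hρ (mem_WsLoc_bracket hq)) hβ hφ hm hconj
  filter_upwards [hU, hS] with q h1 h2 hq
  exact ⟨h1 hq, h2 hq⟩

/-- Extension of a measurable conjugacy from its values at the base points, along unstable and then
stable holonomies. -/
lemma exists_continuous_extension {μ : Measure (Omega P)} [IsProbabilityMeasure μ]
    (hf : IsBunched ρ a (shift P) f C M Λ) (hg : IsBunched ρ a (shift P) g C' M' 1)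
    {β γ B : ℝ≥0} (hφ : ∀ x, MemHolder β (φ x))
    (hBs : ∀ x y, Asymptotic ρ (shift P) 1 x y → HolderWith B γ (hol (shift P) f x y))
    (hBu : ∀ x y, Asymptotic ρ (shift P).symm 1 x y →
      HolderWith B γ (hol (shift P).symm (reversal f) x y))
    {W : Fin k → Omega P} (hW : ∀ x : Omega P, (W (x.1 0)).1 0 = x.1 0)
    (hWφ : ∀ᵐ y ∂μ, IntertwinesHol f g φ (W (y.1 0)) y) :
    ∃ ψ : Omega P → G ≃ₜ G, (∀ᵐ x ∂μ, φ x = ψ x) ∧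
      (Continuous fun q : Omega P × G => ψ q.1 q.2) ∧
      ∃ D : ℝ≥0, ∀ x, HolderWith D (γ * (γ * β)) (ψ x) := by
  have hρ := hf.one_lt
  let z : Omega P → Omega P := fun x => bracket (W (x.1 0)) x
  have hz : Continuous z := continuous_bracket_of_basePoints hW
  have hw : Continuous fun x : Omega P => W (x.1 0) :=
    (continuous_of_discreteTopology (f := W)).comp (continuous_val_apply 0)
  have hu : ∀ x, Asymptotic ρ (shift P).symm 1 (W (x.1 0)) (z x) := fun x =>
    asymptotic_one_of_mem_WuLoc hρ (bracket_mem_WuLoc (hW x))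
  have hs : ∀ x, Asymptotic ρ (shift P) 1 (z x) x := fun x =>
    asymptotic_one_of_mem_WsLoc hρ (mem_WsLoc_bracket (hW x))
  let ψ : Omega P → G ≃ₜ G := fun x =>
    holHomeo hf (hs x) * holHomeo hf.reversal (hu x) * φ (W (x.1 0)) *
      (holHomeo hg.reversal (hu x))⁻¹ * (holHomeo hg (hs x))⁻¹
  have hψ : ∀ x p, ψ x p = hol (shift P) f (z x) x (hol (shift P).symm (reversal f) (W (x.1 0)) (z x)
      (φ (W (x.1 0)) (hol (shift P).symm (reversal g) (z x) (W (x.1 0))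
        (hol (shift P) g x (z x) p)))) := fun x p => rfl
  refine ⟨ψ, ?_, ?_, ?_⟩
  · filter_upwards [hWφ] with x hx
    ext p
    have h1 := hx.2 (hol (shift P) g x (z x) p)
    rw [hg.hol_hol_symm zero_le_one (hs x).symm p] at h1
    have h2 := hx.1 (hol (shift P).symm (reversal g) (z x) (W (x.1 0))
      (hol (shift P) g x (z x) p))
    rw [hg.reversal.hol_hol_symm zero_le_one (hu x).symm] at h2
    rw [h1, hψ, ← h2]
  · simp only [hψ]
    have hσ := (shift P).continuous
    have hσ' := (shift P).symm.continuous
    have hφc : Continuous fun q : Fin k × G => φ (W q.1) q.2 :=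
      continuous_prod_of_discrete_left.2 fun i => (φ (W i)).continuous
    have c1 : Continuous fun q : Omega P × G => q.1 := continuous_fst
    have hx0 : Continuous fun q : Omega P × G => q.1.1 0 :=
      (continuous_val_apply 0).comp c1
    refine hf.continuous_hol_comp hσ (hz.comp c1) c1 ?_ fun q => hs q.1
    refine hf.reversal.continuous_hol_comp hσ' (hw.comp c1) (hz.comp c1) ?_ fun q => hu q.1
    refine hφc.comp (hx0.prodMk ?_)
    refine hg.reversal.continuous_hol_comp hσ' (hz.comp c1) (hw.comp c1) ?_ fun q => (hu q.1).symm
    exact hg.continuous_hol_comp hσ c1 (hz.comp c1) continuous_snd fun q => (hs q.1).symm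
  · choose E hE using fun i => hφ (W i)
    have hE' : ∀ i, HolderWith (Finset.univ.sup E) β (φ (W i)) := fun i =>
      (hE i).mono (Finset.le_sup (Finset.mem_univ i))
    have hgs : ∀ x, HolderWith (M' ^ 2).toNNReal 1 (hol (shift P) g x (z x)) := fun x =>
      holderWith_of_dist_le (sq_nonneg _) fun p q => by
        simpa using hg.hol_lipschitz zero_le_one (hs x).symm p q
    have hgu : ∀ x, HolderWith (M' ^ 2).toNNReal 1
        (hol (shift P).symm (reversal g) (z x) (W (x.1 0))) := fun x =>
      holderWith_of_dist_le (sq_nonneg _) fun p q => by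
        simpa using hg.reversal.hol_lipschitz zero_le_one (hu x).symm p q
    have h := fun x => (hBs _ _ (hs x)).comp ((hBu _ _ (hu x)).comp
      ((hE' (x.1 0)).comp ((hgu x).comp (hgs x))))
    simp only [mul_one] at h
    exact ⟨_, h⟩

/-- The rigidity statement for bunched cocycles. The exponent `a γ² β` comes from the `a`-Hölder
dependence of the holonomies on the base points and from the `γ² β`-Hölder continuity of the values
of the conjugacy, each of which is the composition of its value at a base point with two `γ`-Hölder
holonomies of `f` and two Lipschitz holonomies of `g`. -/
theorem exists_holder_conjugacy {μ : Measure (Omega P)} [IsProbabilityMeasure μ]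
    [μ.IsOpenPosMeasure] (hσ : MeasurePreserving (shift P) μ μ) (hμ : HasLocalProductStructure μ)
    (hf : IsBunched ρ a (shift P) f C M Λ) (hg : IsBunched ρ a (shift P) g C' M' 1)
    {β γ B : ℝ≥0} (hβ : 0 < β) (hβ1 : β ≤ 1) (hγ1 : γ ≤ 1) (hφ : ∀ x, IsHolderHomeo β (φ x))
    (hm : ∀ U : Set C(G, G), IsOpen U → NullMeasurableSet {x | (φ x : C(G, G)) ∈ U} μ)
    (hconj : ∀ᵐ x ∂μ, f x = φ (shift P x) * g x * (φ x)⁻¹)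
    (hBs : ∀ x y, Asymptotic ρ (shift P) 1 x y → HolderWith B γ (hol (shift P) f x y))
    (hBu : ∀ x y, Asymptotic ρ (shift P).symm 1 x y →
      HolderWith B γ (hol (shift P).symm (reversal f) x y)) :
    ∃ ψ : Omega P → G ≃ₜ G, (∀ᵐ x ∂μ, φ x = ψ x) ∧
      (∀ x, f x = ψ (shift P x) * g x * (ψ x)⁻¹) ∧
      ∃ K : ℝ, ∀ x y,
        dUnif (ψ x) (ψ y) ≤ K * dOmega ρ x y ^ (a * (γ * (γ * β) : ℝ≥0)) := by
  have hρ := hf.one_lt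
  have hae := ae_intertwinesHol hσ hμ hf hg hβ (fun x => (hφ x).2) hm hconj
  obtain ⟨W, hW, hWφ⟩ := exists_basePoints hae
  obtain ⟨ψ, hφψ, hψc, D, hD⟩ := exists_continuous_extension hf hg (fun x => (hφ x).1) hBs hBu hW hWφ
  have hψx : ∀ p, Continuous fun x => ψ x p := fun p =>
    hψc.comp (continuous_id.prodMk continuous_const)
  refine ⟨ψ, hφψ, ?_, ?_⟩
  · have key : ∀ p x, f x (ψ x p) = ψ (shift P x) (g x p) := by
      intro p
      refine forall_of_ae_of_isClosed (μ := μ) (isClosed_eq ?_ ?_) ?_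
      · exact hf.continuous_apply.comp (continuous_id.prodMk (hψx p))
      · exact hψc.comp ((shift P).continuous.prodMk
          (hg.continuous_apply.comp (continuous_id.prodMk continuous_const)))
      · filter_upwards [hconj, hφψ, hσ.quasiMeasurePreserving.ae hφψ] with x h1 h2 h3
        rw [← h2, ← h3, h1]
        exact congrArg (fun q => φ (shift P x) (g x q)) ((φ x).symm_apply_apply p)
    intro x
    rw [eq_mul_inv_iff_mul_eq]
    ext p
    exact key p x
  · have he1 : γ * (γ * β) ≤ 1 := mul_le_one' hγ1 (mul_le_one' hγ1 hβ1)
    obtain ⟨K₁, hK₁, hs⟩ := exists_dist_le_of_conj_hol hf hg (D := D) he1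
    obtain ⟨K₂, hK₂, hu⟩ := exists_dist_le_of_conj_hol hf.reversal hg.reversal (D := D) he1
    set e : ℝ := a * (γ * (γ * β) : ℝ≥0)
    -- the estimate at almost every pair, through the bracket
    have hest : ∀ N : ℕ, ∀ᵐ q ∂μ.prod μ, (q.1.1 0 = q.2.1 0 ∧ AgreeBelow N q.1 q.2) →
        ∀ p, dist (ψ q.1 p) (ψ q.2 p) ≤ (K₁ + K₂) * ((ρ ^ N)⁻¹) ^ e := by
      intro N
      filter_upwards [hae, Measure.quasiMeasurePreserving_fst.ae hφψ,
        Measure.quasiMeasurePreserving_snd.ae hφψ] with q h h1 h2 hq p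
      obtain ⟨x, y⟩ := q
      obtain ⟨hxy, hN⟩ := hq
      have hr1 : (ρ ^ N)⁻¹ ≤ 1 := inv_le_one_of_one_le₀ (one_le_pow₀ hρ.le)
      obtain ⟨hU, hS⟩ := h hxy
      have hxu := bracket_mem_WuLoc hxy
      have hys := mem_WsLoc_bracket hxy
      have d1 := hu x (bracket x y) (φ x) (φ (bracket x y)) _ (asymptotic_of_mem_WuLoc hρ hxu)
        (by rw [h1]; exact hD x) hU (dOmega_le_of_agree hρ (hN.bracket_right hxy)) hr1 p
      have hS' : ∀ p, φ (bracket x y) (hol (shift P) g y (bracket x y) p) =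
          hol (shift P) f y (bracket x y) (φ y p) := by
        intro p
        have has := asymptotic_one_of_mem_WsLoc hρ hys
        have h3 := hS (hol (shift P) g y (bracket x y) p)
        rw [hg.hol_hol_symm zero_le_one has.symm p] at h3
        rw [h3, hf.hol_hol_symm zero_le_one has]
      have d2 := hs y (bracket x y) (φ y) (φ (bracket x y)) _
        (by rw [dOmega_comm]; exact (asymptotic_of_mem_WsLoc hρ hys).symm)
        (by rw [h2]; exact hD y) hS' (dOmega_le_of_agree hρ (hN.bracket_left hxy).symm) hr1 p
      rw [← h1, ← h2]
      calc _ ≤ _ := dist_triangle_left _ _ (φ (bracket x y) p)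
        _ ≤ _ := add_le_add d1 d2
        _ = _ := by ring
    have hall : ∀ (N : ℕ) (x y : Omega P), x.1 0 = y.1 0 → AgreeBelow N x y →
        ∀ p, dist (ψ x p) (ψ y p) ≤ (K₁ + K₂) * ((ρ ^ N)⁻¹) ^ e := by
      intro N x y hxy hN p
      have hop : IsOpen {q : Omega P × Omega P | q.1.1 0 = q.2.1 0} :=
        (isOpen_discrete {q : Fin k × Fin k | q.1 = q.2}).preimage
          (((continuous_val_apply 0).comp continuous_fst).prodMk
            ((continuous_val_apply 0).comp continuous_snd))
      exact forall_of_ae_of_isClosed (μ := μ.prod μ)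
        (p := fun q => (q.1.1 0 = q.2.1 0 ∧ AgreeBelow N q.1 q.2) →
          dist (ψ q.1 p) (ψ q.2 p) ≤ (K₁ + K₂) * ((ρ ^ N)⁻¹) ^ e)
        (isClosed_imp (hop.inter (isOpen_agreeBelow N)) (isClosed_le
          (((hψx p).comp continuous_fst).dist ((hψx p).comp continuous_snd)) continuous_const))
        ((hest N).mono fun q hq h => hq h p) (x, y) ⟨hxy, hN⟩
    set Δ := Metric.diam (Set.univ : Set G)
    have hΔ0 : 0 ≤ Δ := Metric.diam_nonneg
    refine ⟨K₁ + K₂ + Δ, fun x y => ?_⟩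
    have hd0 : 0 ≤ dOmega ρ x y ^ e := Real.rpow_nonneg (dOmega_nonneg hρ x y) _
    refine (ContinuousMap.dist_le (mul_nonneg (by positivity) hd0)).2 fun p => ?_
    change dist (ψ x p) (ψ y p) ≤ _
    by_cases hne : x = y
    · rw [show dist (ψ x p) (ψ y p) = 0 by rw [hne, dist_self]]
      exact mul_nonneg (by positivity) hd0
    obtain ⟨N, hN, -, hd⟩ := exists_dOmega_eq hne
    by_cases hxy : x.1 0 = y.1 0
    · refine (hall N x y hxy hN p).trans ?_
      rw [hd]
      have : 0 ≤ ((ρ ^ N)⁻¹) ^ e := by rw [← hd]; exact hd0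
      nlinarith
    · -- distinct zeroth symbols are at distance `1`
      have hN0 : N = 0 := by
        by_contra h0
        exact hxy (hN 0 (by simpa using Nat.pos_of_ne_zero h0))
      rw [hd, hN0, pow_zero, inv_one, Real.one_rpow, mul_one]
      have : dist (ψ x p) (ψ y p) ≤ Δ :=
        Metric.dist_le_diam_of_mem isCompact_univ.isBounded trivial trivial
      linarith

end Main

end LipCocycle

open LipCocycle
theorem theoremB (α : ℝ≥0) (hα0 : 0 < α) (hα1 : α ≤ 1) (θ : ℝ) (hθ : 0 < θ) :
    ∃ γ : ℝ≥0, 0 < γ ∧ γ < α ∧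
      ∀ (ρ : ℝ), 1 < ρ →
      ∀ (k : ℕ) (P : Matrix (Fin k) (Fin k) ℕ), IsTransitionMatrix P →
      ∀ (G : Type*) [AddGroup G] [MetricSpace G] [IsTopologicalAddGroup G] [CompactSpace G]
        (f : Omega P → G ≃ₜ G),
        IsHolderCocycle ρ α f → IsSUDominatedWith ρ α θ f →
        HasHolderHolonomies f γ ∧
        ∀ (μ : Measure (Omega P)) [IsProbabilityMeasure μ] [μ.IsOpenPosMeasure],
          Ergodic (shift P) μ → HasLocalProductStructure μ →
        ∀ g : Omega P → G ≃ₜ G, IsHolderCocycle ρ α g → HasBoundedDistortion μ g →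
        ∀ β : ℝ≥0, 0 < β → β ≤ 1 →
        ∀ φ : Omega P → G ≃ₜ G,
          (∀ x, IsHolderHomeo β (φ x)) →
          (∀ U : Set C(G, G), IsOpen U → NullMeasurableSet {x | (φ x : C(G, G)) ∈ U} μ) →
          (∀ᵐ x ∂μ, f x = φ (shift P x) * g x * (φ x)⁻¹) →
          ∃ ψ : Omega P → G ≃ₜ G,
            (∀ᵐ x ∂μ, φ x = ψ x) ∧
            (∀ x, f x = ψ (shift P x) * g x * (ψ x)⁻¹) ∧
            ∃ C : ℝ, ∀ x y, dUnif (ψ x) (ψ y) ≤ C * dOmega ρ x y ^ ((β * γ : ℝ≥0) : ℝ) := by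
  -- decreasing `θ` weakens the domination, so `θ ≤ α / 2` may be assumed;
  -- `γ₀` is a Hölder exponent of the holonomies
  set θ' : ℝ := min θ (α / 2)
  have hα0' : (0 : ℝ) < α := by exact_mod_cast hα0
  have hα1' : (α : ℝ) ≤ 1 := by exact_mod_cast hα1
  have hθ0 : 0 < θ' := lt_min hθ (by positivity)
  have hθ2 : θ' ≤ α / 2 := min_le_right _ _
  set γ₀ : ℝ≥0 := (θ' / 2).toNNReal
  have hγ₀ : (γ₀ : ℝ) = θ' / 2 := Real.coe_toNNReal _ (by positivity)
  have hγpos : 0 < γ₀ := Real.toNNReal_pos.2 (by positivity)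
  have hγlt : γ₀ < 1 := by
    rw [← NNReal.coe_lt_coe, hγ₀, NNReal.coe_one]
    linarith
  have hγγ : γ₀ * γ₀ < 1 := mul_lt_one_of_nonneg_of_lt_one_left bot_le hγlt hγlt.le
  have hle : α * (γ₀ * γ₀) ≤ γ₀ := by
    calc α * (γ₀ * γ₀) ≤ 1 * (1 * γ₀) := by gcongr
      _ = γ₀ := by rw [one_mul, one_mul]
  refine ⟨α * (γ₀ * γ₀), by positivity, mul_lt_of_lt_one_right hα0 hγγ, ?_⟩
  intro ρ hρ k P _ G _ _ _ _ f hf hd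
  obtain ⟨C, hfb⟩ := exists_isBunched_of_isSUDominatedWith hρ hα0 hf hd hθ0 (min_le_left _ _)
  have hθα : θ' ≤ α := by linarith
  refine ⟨hasHolderHolonomies_of_isBunched hα1 hθ0 hθα ?_ hfb, ?_⟩
  · rw [← hγ₀]
    exact_mod_cast hle
  intro μ _ _ hμe hμ g hg hgd β hβ hβ1 φ hφ hm hconj
  obtain ⟨C', M', hgb⟩ := exists_isBunched_of_hasBoundedDistortion hρ hα0 hg hgd
  obtain ⟨B₁, hB₁⟩ := hfb.exists_holderWith_hol hα1 hθ0 hθα hγ₀.le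
  obtain ⟨B₂, hB₂⟩ := hfb.reversal.exists_holderWith_hol hα1 hθ0 hθα hγ₀.le
  obtain ⟨ψ, h1, h2, K, hK⟩ := exists_holder_conjugacy (B := max B₁ B₂) hμe.toMeasurePreserving hμ
    hfb hgb hβ hβ1 hγlt.le hφ hm hconj (fun x y h => (hB₁ x y h).mono (le_max_left _ _))
    (fun x y h => (hB₂ x y h).mono (le_max_right _ _))
  refine ⟨ψ, h1, h2, K, fun x y => ?_⟩
  have he : ((β * (α * (γ₀ * γ₀)) : ℝ≥0) : ℝ) = α * (γ₀ * (γ₀ * β) : ℝ≥0) := by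
    push_cast
    ring
  rw [he]
  exact hK x y
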